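/- **Conventions.** Let $C$ be a triangulated category. A $t$-structure $t=(C^{t\le 0},C^{t\ge 0})$ on $C$ has $C^{t\le n}=C^{t\le 0}[-n]$, $C^{t\ge n}=C^{t\ge 0}[-n]$; its heart is $H_t=C^{t\le 0}\cap C^{t\ge 0}$ (an abelian category), and $Y^{\tau=0}=\tau_{\ge 0}\tau_{\le 0}Y\in H_t$. A weight structure $w=(C^{w\le 0},C^{w\ge 0})$ on $C$ consists of two additive classes of objects closed under retracts in $C$, with $C^{w\ge 0}[1]\subset C^{w\ge 0}$, $C^{w\le 0}[-1]\subset C^{w\le 0}$ and $C(X,Y[1])=0$ for $X\in C^{w\le 0}$, $Y\in C^{w\ge 0}$, such that each $X\in C$ lies in a distinguished triangle $A\to X\to B[1]\to A[1]$ with $A\in C^{w\le 0}$, $B\in C^{w\ge 0}$; put $C^{w\le n}=C^{w\le 0}[n]$, $C^{w\ge n}=C^{w\ge 0}[n]$. A $t$-structure (resp. weight structure) is bounded if each object lies in $C^{t\ge a}\cap C^{t\le b}$ (resp. $C^{w\ge a}\cap C^{w\le b}$) for some $a,b\in\mathbb Z$. A weight decomposition of $X$ at $i$ is a distinguished triangle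 $w_{\le i}X\to X\to w_{\ge i+1}X\to(w_{\le i}X)[1]$ with $w_{\le i}X\in C^{w\le i}$, $w_{\ge i+1}X\in C^{w\ge i+1}$ (it is not unique); it is *nice* (for $t$) if $w_{\le i}X,X,w_{\ge i+1}X\in H_t$. A morphism $L\to X$ extends to a nice decomposition (at $i$) if it is the first morphism of a nice decomposition of $X$ at $i$. The envelope of a class of objects is the smallest class containing it that contains $Y$ whenever there is a distinguished triangle $X\to Y\to Z\to X[1]$ with $X,Z$ in the class. A *family* $\{A_i\}_{i\in\mathbb Z}$ consists of strictly full additive subcategories of $C$. It is *semi-orthogonal* if $C(X,Y[s])=0$ for all $X\in A_i$, $Y\in A_j$ whenever $s<0$ or $s>i-j$, and *strongly semi-orthogonal* if moreover $C(X,Y)=0$ for $X\in A_i$, $Y\in A_j$, $i>j$. It is *generating* if $C$ is the smallest strictly full triangulated subcategory of $C$ containing all $A_i$. An abelian category is *semi-simple* if all its short exact sequences split. If $A_i\subset H_t$ for all $i$, a *weight filtration* of $X\in H_t$ is an increasing family of subobjects $W_{\le i}X\subset X$ in $H_t$ ($i\in\mathbb Z$) which is separated ($W_{\le i}X=0$ for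 $i\ll 0$) and exhaustive ($W_{\le i}X=X$ for $i\gg 0$), with $W_{\le i}X/W_{\le i-1}X\in A_i$ for all $i$. **Theorem.** Let $C$ be a triangulated category. (A) The following conditions are equivalent. * (i) There is a strongly semi-orthogonal generating family $\{A_i\}$ in $C$ with all $A_i$ abelian semi-simple. * (ii) There is a semi-orthogonal family $\{A_i\}$ in $C$ such that, for $C^{t\le 0}$ (resp. $C^{t\ge 0}$) the envelope of $\bigcup_{i\in\mathbb Z,\,j\ge 0}A_i[j]$ (resp. of $\bigcup_{i\in\mathbb Z,\,j\le 0}A_i[j]$), the pair $(C^{t\le 0},C^{t\ge 0})$ is a bounded $t$-structure on $C$. * (ii') There is a semi-orthogonal family $\{A_i\}$ in $C$ such that the envelope of $\bigcup_i A_i$ is the heart of a bounded $t$-structure on $C$. * (iii) There are a bounded $t$-structure $t$ on $C$ and a semi-orthogonal family $\{A_i\}$ with $A_i\subset H_t$ such that every $X\in H_t$ has a weight filtration. * (iii') There are $t$ and $\{A_i\}$ as in (iii) for which moreover the weight filtration of $X$ is $H_t$-functorially determined by $X$: every morphism $X\to Y$ in $H_t$ maps $W_{\le i}X$ into $W_{\le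 i}Y$ for all $i$ and all weight filtrations of $X$ and $Y$ (so each $X$ has exactly one). * (iv) There are a bounded $t$-structure $t$ and a bounded weight structure $w$ on $C$ such that each $X\in H_t$ has a nice decomposition at each $i\in\mathbb Z$. * (iv') There are bounded $t,w$ on $C$ such that each $X\in H_t$ has a nice decomposition at each $i\in\mathbb Z$, and for each fixed $i$ nice decompositions are functorial: each morphism $X\to Y$ of $H_t$ extends uniquely to a morphism between any given nice decompositions of $X$ and $Y$, and nice decompositions can be given by functors $X\mapsto w_{\le i}X$ and $X\mapsto w_{\ge i+1}X$ from $H_t$ to $H_t$ (with all three morphisms of the triangles natural in $X$) which are exact. * (v) There are bounded $t,w$ on $C$ such that for all $X\in H_t$ and $i\in\mathbb Z$ there is a choice of $w_{\le i}X$ for which the morphism $\operatorname{Im}\bigl((w_{\le i}X)^{\tau=0}\to X\bigr)\to X$ (image in $H_t$) extends to a nice decomposition of $X$ at $i$. * (v') There are bounded $t,w$ on $C$ such that for all $X\in H_t$, $i\in\mathbb Z$ and every choice of $w_{\le i}X$ the morphism $\operatorname{Im}\bigl((w_{\le i}X)^{\tau=0}\to X\bigr)\to X$ extends to a nice decomposition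 of $X$ at $i$. (B) For each given bounded $t$-structure $t$ and bounded weight structure $w$ on $C$, the properties of the pair $(t,w)$ required in (iv), (iv'), (v) and (v') are equivalent. If they hold, $t$ is called transversal to $w$. -/

import Mathlib

open CategoryTheory CategoryTheory.Limits CategoryTheory.Pretriangulated
open CategoryTheory.Triangulated

universe v u

namespace TransversalWeights

section SemisimpleAbelian

/-- A preadditive category is abelian and semi-simple if it is abelian (finite products,
kernels and cokernels exist, every monomorphism is a kernel and every epimorphism is a
cokernel) and every short exact sequence in it splits. -/
structure IsSemisimpleAbelian (H : Type u) [Category.{v} H] [Preadditive H] : Prop where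
  hasFiniteProducts : HasFiniteProducts H
  hasKernels : HasKernels H
  hasCokernels : HasCokernels H
  isNormalMonoCategory : IsNormalMonoCategory H
  isNormalEpiCategory : IsNormalEpiCategory H
  splits : ∀ S : ShortComplex H, S.ShortExact → Nonempty S.Splitting

/-- The abelian structure, compatible with the given preadditive structure. -/
@[reducible] def IsSemisimpleAbelian.abelian {H : Type u} [Category.{v} H] [inst : Preadditive H]
    (h : IsSemisimpleAbelian H) : Abelian H :=
  haveI := h.hasFiniteProducts
  haveI := h.hasKernels
  haveI := h.hasCokernels
  { toPreadditive := inst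
    toIsNormalMonoCategory := h.isNormalMonoCategory
    toIsNormalEpiCategory := h.isNormalEpiCategory }

end SemisimpleAbelian

variable (C : Type u) [Category.{v} C] [HasZeroObject C] [HasShift C ℤ] [Preadditive C]
  [∀ n : ℤ, (shiftFunctor C n).Additive] [Pretriangulated C]

section WeightStructures

/-- A weight structure on `C`, in the sign convention for which `C^{w ≥ 0}` is stable under
`[1]` and `C^{w ≤ 0}` is stable under `[-1]`. -/
structure WeightStructure where
  /-- the class `C^{w ≤ 0}` -/
  leZero : ObjectProperty C
  /-- the class `C^{w ≥ 0}` -/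
  geZero : ObjectProperty C
  /-- both classes are additive and Karoubi-closed in `C` -/
  leZero_finiteProducts : leZero.IsClosedUnderFiniteProducts
  geZero_finiteProducts : geZero.IsClosedUnderFiniteProducts
  leZero_retracts : leZero.IsStableUnderRetracts
  geZero_retracts : geZero.IsStableUnderRetracts
  /-- semi-invariance with respect to translations -/
  leZero_shift : ∀ X : C, leZero X → leZero (X⟦(-1 : ℤ)⟧)
  geZero_shift : ∀ X : C, geZero X → geZero (X⟦(1 : ℤ)⟧)
  /-- orthogonality: `C^{w ≤ 0} ⟂ C^{w ≥ 0}[1]` -/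
  orthogonal : ∀ X Y : C, leZero X → geZero Y → ∀ f : X ⟶ Y⟦(1 : ℤ)⟧, f = 0
  /-- weight decompositions: every `X` lies in a distinguished triangle `A ⟶ X ⟶ B[1] ⟶ A[1]`
  with `A ∈ C^{w ≤ 0}` and `B ∈ C^{w ≥ 0}` -/
  exists_decomposition : ∀ X : C, ∃ (A B : C) (f : A ⟶ X) (g : X ⟶ B⟦(1 : ℤ)⟧)
    (h : B⟦(1 : ℤ)⟧ ⟶ A⟦(1 : ℤ)⟧), leZero A ∧ geZero B ∧ Triangle.mk f g h ∈ distTriang C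

variable {C}

/-- The class `C^{w ≤ n} = C^{w ≤ 0}[n]`. -/
def WeightStructure.le (w : WeightStructure C) (n : ℤ) : ObjectProperty C :=
  w.leZero.shift (-n)

/-- The class `C^{w ≥ n} = C^{w ≥ 0}[n]`. -/
def WeightStructure.ge (w : WeightStructure C) (n : ℤ) : ObjectProperty C :=
  w.geZero.shift (-n)

/-- `w` is bounded: every object belongs to `C^{w ≥ a} ∩ C^{w ≤ b}` for some `a`, `b`. -/
def WeightStructure.IsBounded (w : WeightStructure C) : Prop :=
  ∀ X : C, ∃ a b : ℤ, w.ge a X ∧ w.le b X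

/-- `t` is bounded: every object belongs to `C^{t ≥ a} ∩ C^{t ≤ b}` for some `a`, `b`. -/
def IsBoundedTStructure (t : TStructure C) : Prop :=
  ∀ X : C, ∃ a b : ℤ, t.ge a X ∧ t.le b X

end WeightStructures

section Families

variable {C}

/-- The envelope of a class of objects: the smallest class containing it which is
extension-stable, i.e. contains `Y` whenever `X ⟶ Y ⟶ Z ⟶ X[1]` is distinguished and
it contains `X` and `Z`. -/
inductive Envelope (P : ObjectProperty C) : ObjectProperty C
  | of (X : C) (hX : P X) : Envelope P X
  | ext (T : Triangle C) (hT : T ∈ distTriang C) (h₁ : Envelope P T.obj₁)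
      (h₃ : Envelope P T.obj₃) : Envelope P T.obj₂

/-- A family `A i`, `i ∈ ℤ`, of strictly full additive subcategories of `C`. -/
structure IsAdditiveFamily (A : ℤ → ObjectProperty C) : Prop where
  isClosedUnderIsomorphisms : ∀ i, (A i).IsClosedUnderIsomorphisms
  isClosedUnderFiniteProducts : ∀ i, (A i).IsClosedUnderFiniteProducts

/-- `A i ⟂ A j [s]` whenever `s < 0` or `s > i - j`. -/
def IsSemiOrthogonal (A : ℤ → ObjectProperty C) : Prop :=
  ∀ i j s : ℤ, (s < 0 ∨ i - j < s) → ∀ X Y : C, A i X → A j Y → ∀ f : X ⟶ Y⟦s⟧, f = 0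

/-- Semi-orthogonality together with `A i ⟂ A j` for all `i > j`. -/
def IsStronglySemiOrthogonal (A : ℤ → ObjectProperty C) : Prop :=
  IsSemiOrthogonal A ∧
    ∀ i j : ℤ, j < i → ∀ X Y : C, A i X → A j Y → ∀ f : X ⟶ Y, f = 0

/-- The smallest strictly full triangulated subcategory containing all the `A i` is `C`. -/
def IsGenerating (A : ℤ → ObjectProperty C) : Prop :=
  ∀ P : ObjectProperty C, P.IsTriangulated → P.IsClosedUnderIsomorphisms →
    (∀ i, A i ≤ P) → ∀ X : C, P X

/-- The class `⋃ A i [j]`, over all `i ∈ ℤ` and all `j ∈ J`. -/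
def shiftsIn (A : ℤ → ObjectProperty C) (J : Set ℤ) : ObjectProperty C :=
  fun X => ∃ (i j : ℤ) (Y : C), j ∈ J ∧ A i Y ∧ Nonempty (X ≅ Y⟦j⟧)

/-- `C^{t ≤ 0}` is the envelope of `⋃_{i, j ≥ 0} A i [j]` and `C^{t ≥ 0}` is the envelope of
`⋃_{i, j ≤ 0} A i [j]`. -/
def EnvelopesGiveTStructure (t : TStructure C) (A : ℤ → ObjectProperty C) : Prop :=
  t.le 0 = Envelope (shiftsIn A (Set.Ici 0)) ∧ t.ge 0 = Envelope (shiftsIn A (Set.Iic 0))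

/-- The heart of `t` is the envelope of `⋃ A i`. -/
def EnvelopeGivesHeart (t : TStructure C) (A : ℤ → ObjectProperty C) : Prop :=
  t.heart = Envelope (fun X => ∃ i, A i X)

end Families

section HeartFiltrations

variable {C} (t : TStructure C) (A : ℤ → ObjectProperty C)

/-- An increasing filtration `W i = W_{≤ i} X`, `i ∈ ℤ`, of an object `X` of the heart of `t` by
subobjects (in the heart), which is separated (`W_{≤ i} X = 0` for `i` small enough) and
exhaustive (`W_{≤ i} X = X` for `i` large enough), with quotients `W_{≤ i} X / W_{≤ i - 1} X`
(cokernels in the heart) belonging to `A i`. -/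
structure HeartFiltration (X : t.heart.FullSubcategory) where
  W : ℤ → Subobject X
  mono : Monotone W
  separated : ∃ a : ℤ, IsZero (W a : t.heart.FullSubcategory)
  exhaustive : ∃ b : ℤ, W b = ⊤
  graded : ∀ i : ℤ, ∃ (G : t.heart.FullSubcategory) (p : (W i : t.heart.FullSubcategory) ⟶ G)
    (hp : Subobject.ofLE (W (i - 1)) (W i) (mono (by lia)) ≫ p = 0),
    Nonempty (IsColimit (CokernelCofork.ofπ p hp)) ∧ A i G.obj

/-- Every object of the heart has a filtration as above. -/
def HasHeartFiltrations : Prop :=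
  ∀ X : t.heart.FullSubcategory, Nonempty (HeartFiltration t A X)

/-- The filtration is functorially determined by the object: every morphism `X ⟶ Y` of the heart
maps `W_{≤ i} X` into `W_{≤ i} Y` for any such filtrations of `X` and `Y`
(with the identity of `X`, this says that the filtration of `X` is unique). -/
def HeartFiltrationsFunctorial : Prop :=
  ∀ (X Y : t.heart.FullSubcategory) (F : HeartFiltration t A X) (F' : HeartFiltration t A Y)
    (f : X ⟶ Y) (i : ℤ), (F'.W i).Factors ((F.W i).arrow ≫ f)

end HeartFiltrations

section NiceDecompositions

variable {C} (t : TStructure C) (w : WeightStructure C)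

/-- `T` is a triangle `w_{≤ i} X ⟶ X ⟶ w_{≥ i + 1} X ⟶ (w_{≤ i} X)[1]` (where `X = T.obj₂`). -/
structure IsWeightDecomposition (i : ℤ) (T : Triangle C) : Prop where
  distinguished : T ∈ distTriang C
  le : w.le i T.obj₁
  ge : w.ge (i + 1) T.obj₃

/-- A nice decomposition: a weight decomposition all of whose terms are in the heart of `t`. -/
structure IsNiceDecomposition (i : ℤ) (T : Triangle C) : Prop
    extends IsWeightDecomposition w i T where
  heart₁ : t.heart T.obj₁
  heart₂ : t.heart T.obj₂
  heart₃ : t.heart T.obj₃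

/-- The morphism `f : L ⟶ X` extends to a nice decomposition `L ⟶ X ⟶ R ⟶ L[1]` of `X`. -/
def ExtendsToNiceDecomposition (i : ℤ) {L X : C} (f : L ⟶ X) : Prop :=
  ∃ (R : C) (g : X ⟶ R) (h : R ⟶ L⟦(1 : ℤ)⟧), IsNiceDecomposition t w i (Triangle.mk f g h)

/-- For every object `X` of the heart and every `i` there is a nice decomposition of `X`. -/
def HasNiceDecompositions : Prop :=
  ∀ X : C, t.heart X → ∀ i : ℤ, ∃ T : Triangle C, IsNiceDecomposition t w i T ∧ T.obj₂ = X

/-- For each fixed `i`, nice decompositions are functorial: every morphism `X ⟶ Y` extends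
uniquely to a morphism between given nice decompositions of `X` and `Y`. -/
def NiceDecompositionsFunctorial : Prop :=
  ∀ (i : ℤ) (T T' : Triangle C), IsNiceDecomposition t w i T → IsNiceDecomposition t w i T' →
    ∀ f : T.obj₂ ⟶ T'.obj₂, ∃! φ : T ⟶ T', φ.hom₂ = f

/-- For each fixed `i`, nice decompositions `w_{≤ i} X ⟶ X ⟶ w_{≥ i + 1} X ⟶ (w_{≤ i} X)[1]` are
given by functors `X ↦ w_{≤ i} X`, `X ↦ w_{≥ i + 1} X` from the heart to itself and natural
transformations between them, and these two functors are exact. -/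
def NiceDecompositionFunctorsExact : Prop :=
  ∀ i : ℤ, ∃ (L R : t.heart.FullSubcategory ⥤ t.heart.FullSubcategory)
    (ι : L ⟶ 𝟭 t.heart.FullSubcategory) (π : 𝟭 t.heart.FullSubcategory ⟶ R)
    (δ : R ⋙ t.heart.ι ⟶ L ⋙ t.heart.ι ⋙ shiftFunctor C (1 : ℤ)),
    (∀ X : t.heart.FullSubcategory,
      IsNiceDecomposition t w i (Triangle.mk (ι.app X).hom (π.app X).hom (δ.app X))) ∧
    (PreservesFiniteLimits L ∧ PreservesFiniteColimits L) ∧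
    (PreservesFiniteLimits R ∧ PreservesFiniteColimits R)

/-- Nice decompositions exist and are functorial, and the corresponding functors are exact. -/
def HasExactNiceDecompositions : Prop :=
  HasNiceDecompositions t w ∧ NiceDecompositionsFunctorial t w ∧
    NiceDecompositionFunctorsExact t w

section

variable [IsTriangulated C]

/-- The zeroth cohomology `Y^{τ = 0} = τ_{≥ 0} τ_{≤ 0} Y`, as an object of the heart. -/
noncomputable def cohZero (Y : C) : t.heart.FullSubcategory :=
  ⟨(t.truncGELE 0 0).obj Y,
    (t.mem_heart_iff _).2 ⟨inferInstance, inferInstance⟩⟩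

/-- The morphism `Y^{τ = 0} ⟶ X^{τ = 0} = X` induced by `f : Y ⟶ X`, for `X` in the heart:
the unique one whose composition with `τ_{≤ 0} Y ⟶ τ_{≥ 0} τ_{≤ 0} Y` is
`τ_{≤ 0} Y ⟶ Y ⟶ X`. -/
noncomputable def cohZeroMap {Y : C} {X : t.heart.FullSubcategory} (f : Y ⟶ X.obj) :
    cohZero t Y ⟶ X :=
  haveI : t.IsGE X.obj 0 := ((t.mem_heart_iff _).1 X.property).2
  ObjectProperty.homMk (t.descTruncGE ((t.truncLEι 0).app Y ≫ f) 0)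

/-- For `f : w_{≤ i} X ⟶ X` with `X` in the heart: the morphism `Im ((w_{≤ i} X)^{τ = 0} ⟶ X) ⟶ X`
(the image being taken in the heart) extends to a nice decomposition of `X`. -/
def ImageExtendsToNiceDecomposition (i : ℤ) {L : C} {X : t.heart.FullSubcategory}
    (f : L ⟶ X.obj) : Prop :=
  ∃ I : ImageFactorisation (cohZeroMap t f), ExtendsToNiceDecomposition t w i I.F.m.hom

/-- For all `X` in the heart and all `i`, the above holds for some choice of `w_{≤ i} X ⟶ X`. -/
def SomeImagesExtend : Prop :=
  ∀ (X : t.heart.FullSubcategory) (i : ℤ), ∃ (L R : C) (f : L ⟶ X.obj) (g : X.obj ⟶ R)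
    (h : R ⟶ L⟦(1 : ℤ)⟧), IsWeightDecomposition w i (Triangle.mk f g h) ∧
      ImageExtendsToNiceDecomposition t w i f

/-- For all `X` in the heart and all `i`, the above holds for every choice of
`w_{≤ i} X ⟶ X`. -/
def AllImagesExtend : Prop :=
  ∀ (X : t.heart.FullSubcategory) (i : ℤ) (L R : C) (f : L ⟶ X.obj) (g : X.obj ⟶ R)
    (h : R ⟶ L⟦(1 : ℤ)⟧), IsWeightDecomposition w i (Triangle.mk f g h) →
      ImageExtendsToNiceDecomposition t w i f

end

end NiceDecompositions

end TransversalWeights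

/-!
The condition to which everything is compared is the existence of nice decompositions for a bounded
t-structure `t` and a bounded weight structure `w`.

Nice decompositions equip the heart with a very rigid structure. For each `i`, the objects of the
heart of weights `≤ i` and those of weights `≥ i + 1` form a torsion pair, and the orthogonality
axiom of `w` kills the extensions of the former by the latter
(`HasNiceDecompositions.isSplitTorsionPair`). In an abelian category this forces both classes to be
closed under subobjects and quotients, and the two functors of the torsion pair to be exact
(`IsSplitTorsionPair`). This gives the exactness of nice decompositions. Their functoriality is formal,
by orthogonality for `w` and for `t` (`niceDecompositionsFunctorial`). If `L ⟶ X` is the first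
morphism of any weight decomposition and `L₀ ⟶ X` that of a nice one, each of them factors through
the other, so that `L₀` is the image of `H⁰(L)` in `X` (`allImagesExtend`).

The pure objects of weight `i` of the heart (`pureHeart`) then form a strongly semi-orthogonal family.
As weights in the heart pass to subobjects and quotients, kernels and cokernels of morphisms between
pure objects are pure, and there are no extensions between pure objects of the same weight: this
makes the subcategories abelian and semi-simple
(`HasNiceDecompositions.pureHeart_isSemisimpleAbelian`). They generate, by induction on the length of
the interval of weights. The objects `w_{≤ i} X` form the weight filtration of `X`
(`HasNiceDecompositions.hasHeartFiltrations`), and any weight filtration is functorial since there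
are no morphisms from objects of weight `≤ i` to graded pieces of greater weight
(`HeartFiltration.factors`).

To go back from families to structures, the tool is a sorting principle for iterated extensions
(`Envelope.envelope_sup_le`): if any two adjacent constituents in the wrong order can be
exchanged, then every iterated extension can be sorted. For a semi-orthogonal family, constituents in
`A i [j]` can be sorted by the weight `i + j`, because the relevant connecting morphisms vanish. This
gives a weight structure as soon as the family generates (`IsSemiOrthogonal.weightStructure`).
Applied to the constituents of an object of the heart, the same sorting gives nice decompositions
when the heart is the envelope of the `A i`. When one only knows that `C^{t ≤ 0}` and `C^{t ≥ 0}`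
are envelopes, it gives one weight decomposition inside each of these classes, and these two
have a common direct summand which is nice (`exists_isNiceDecomposition_of_le_of_ge`).

For a strongly semi-orthogonal family of semi-simple abelian subcategories, constituents can also be
sorted by the shift `j`: the only connecting morphisms which do not vanish are morphisms `d` of some
`A i`, and the cone of `d` is an extension of its cokernel by the shift of its kernel. Exchanging the two
constituents amounts to replacing the source of `d` by `ker d` and the target by `coker d`
(`IsStronglySemiOrthogonal.extensionProduct_le`). This gives the t-structure
(`IsStronglySemiOrthogonal.tStructure`).
-/

namespace TransversalWeights

open ObjectProperty

section Envelopes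

variable {C : Type u} [Category.{v} C] [HasZeroObject C] [HasShift C ℤ] [Preadditive C]
  [∀ n : ℤ, (shiftFunctor C n).Additive] [Pretriangulated C]

/-! ### Extension-closed classes and envelopes -/

lemma distinguished_of_iso {X Y Z X' Y' Z' : C} {f : X ⟶ Y} {g : Y ⟶ Z} {h : Z ⟶ X⟦(1 : ℤ)⟧}
    (hT : Triangle.mk f g h ∈ distTriang C) {f' : X' ⟶ Y'} {g' : Y' ⟶ Z'} {h' : Z' ⟶ X'⟦(1 : ℤ)⟧}
    (e₁ : X ≅ X') (e₂ : Y ≅ Y') (e₃ : Z ≅ Z') (comm₁ : f ≫ e₂.hom = e₁.hom ≫ f')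
    (comm₂ : g ≫ e₃.hom = e₂.hom ≫ g') (comm₃ : h ≫ e₁.hom⟦(1 : ℤ)⟧' = e₃.hom ≫ h') :
    Triangle.mk f' g' h' ∈ distTriang C :=
  isomorphic_distinguished _ hT _
    (Triangle.isoMk (Triangle.mk f g h) (Triangle.mk f' g' h') e₁ e₂ e₃ comm₁ comm₂ comm₃).symm

section

variable {X Y Z : C} {f : X ⟶ Y} {g : Y ⟶ Z} {h : Z ⟶ X⟦(1 : ℤ)⟧}
  (hT : Triangle.mk f g h ∈ distTriang C) {W : C}

include hT

lemma comp_eq_zero_of_distinguished : f ≫ g = 0 := comp_distTriang_mor_zero₁₂ _ hT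

lemma exists_lift₂ (φ : W ⟶ Y) (hφ : φ ≫ g = 0) : ∃ ψ : W ⟶ X, φ = ψ ≫ f :=
  Triangle.coyoneda_exact₂ _ hT φ hφ

lemma exists_desc₂ (φ : Y ⟶ W) (hφ : f ≫ φ = 0) : ∃ ψ : Z ⟶ W, φ = g ≫ ψ :=
  Triangle.yoneda_exact₂ _ hT φ hφ

lemma exists_lift₃ (φ : W ⟶ Z) (hφ : φ ≫ h = 0) : ∃ ψ : W ⟶ Y, φ = ψ ≫ g :=
  Triangle.coyoneda_exact₃ _ hT φ hφ

lemma exists_desc₃ (φ : Z ⟶ W) (hφ : g ≫ φ = 0) : ∃ ψ : X⟦(1 : ℤ)⟧ ⟶ W, φ = h ≫ ψ :=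
  Triangle.yoneda_exact₃ _ hT φ hφ

/-- A morphism to the first term which is killed by the first morphism factors through the
shift by `-1` of the third term. -/
lemma exists_lift₁ (φ : W ⟶ X) (hφ : φ ≫ f = 0) :
    ∃ (d : Z⟦(-1 : ℤ)⟧ ⟶ X) (ψ : W ⟶ Z⟦(-1 : ℤ)⟧), φ = ψ ≫ d := by
  obtain ⟨ψ, hψ⟩ := Triangle.coyoneda_exact₂ _ (inv_rot_of_distTriang _ hT) φ hφ
  exact ⟨_, ψ, hψ⟩

lemma exists_shift_distinguished (n : ℤ) : ∃ (f' : X⟦n⟧ ⟶ Y⟦n⟧) (g' : Y⟦n⟧ ⟶ Z⟦n⟧)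
    (h' : Z⟦n⟧ ⟶ X⟦n⟧⟦(1 : ℤ)⟧), Triangle.mk f' g' h' ∈ distTriang C :=
  ⟨_, _, _, Triangle.shift_distinguished _ hT n⟩

end

lemma isClosedUnderFiniteProducts_of_isTriangulatedClosed₂ (P : ObjectProperty C)
    [P.ContainsZero] [P.IsTriangulatedClosed₂] [P.IsClosedUnderIsomorphisms] :
    P.IsClosedUnderFiniteProducts := by
  have : P.IsClosedUnderBinaryProducts :=
    { limitsOfShape_le := by
        rintro X ⟨p⟩
        refine P.prop_of_iso ?_ (P.ext_of_isTriangulatedClosed₂ _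
          (binaryProductTriangle_distinguished _ _)
          (p.prop_diag_obj (.mk .left)) (p.prop_diag_obj (.mk .right)))
        exact IsLimit.conePointUniqueUpToIso (prodIsProd _ _)
          ((IsLimit.postcomposeHomEquiv (diagramIsoPair p.diag) _).2 p.isLimit) }
  exact .mk'

lemma containsZero_of_isClosedUnderFiniteProducts (P : ObjectProperty C)
    [P.IsClosedUnderFiniteProducts] : P.ContainsZero where
  exists_zero := by
    refine ⟨∏ᶜ (fun x : PEmpty.{1} => x.elim), ?_, P.prop_product (fun j => j.elim)⟩
    have h : IsTerminal (∏ᶜ (fun x : PEmpty.{1} => (x.elim : C))) :=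
      IsTerminal.ofUniqueHom (fun X => Pi.lift (fun j => j.elim))
        (fun X m => Pi.hom_ext _ _ (fun j => j.elim))
    exact (isZero_zero C).of_iso (h.uniqueUpToIso (isZero_zero C).isTerminal)

instance retractClosure_isTriangulatedClosed₂ (P : ObjectProperty C) [P.IsTriangulatedClosed₂]
    [P.IsClosedUnderIsomorphisms] : P.retractClosure.IsTriangulatedClosed₂ :=
  .mk' fun T hT h₁ h₃ =>
    ObjectProperty.monotone_retractClosure
      (extensionProduct_le_of_isTriangulatedClosed₂ (P₁ := P) (P₂ := P) le_rfl le_rfl) _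
      (extensionProduct_retractClosure_retractClosure_le P P _
        ⟨_, _, T.mor₁, T.mor₂, T.mor₃, hT, h₁, h₃⟩)

namespace Envelope

variable {P Q : ObjectProperty C}

lemma le_envelope (P : ObjectProperty C) : P ≤ Envelope P := fun X hX => .of X hX

instance : (Envelope P).IsTriangulatedClosed₂ where
  ext₂' T hT h₁ h₃ := le_isoClosure _ _ (.ext T hT h₁ h₃)

instance [P.ContainsZero] : (Envelope P).ContainsZero where
  exists_zero := by
    obtain ⟨Z, hZ, h⟩ := P.exists_prop_of_containsZero
    exact ⟨Z, hZ, .of _ h⟩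

instance [P.IsClosedUnderIsomorphisms] : (Envelope P).IsClosedUnderIsomorphisms where
  of_iso := by
    intro X Y e hX
    induction hX generalizing Y with
    | of X hX => exact .of _ (P.prop_of_iso e hX)
    | ext T hT h₁ h₃ =>
      exact .ext (Triangle.mk (T.mor₁ ≫ e.hom) (e.inv ≫ T.mor₂) T.mor₃)
        (distinguished_of_iso hT (Iso.refl _) e (Iso.refl _) (by simp) (by simp) (by simp)) h₁ h₃

/-- The universal property of the envelope. -/
lemma le_of_le [Q.IsTriangulatedClosed₂] [Q.IsClosedUnderIsomorphisms] (h : P ≤ Q) :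
    Envelope P ≤ Q := by
  intro X hX
  induction hX with
  | of X hX => exact h _ hX
  | ext T hT _ _ h₁ h₃ => exact Q.ext_of_isTriangulatedClosed₂ T hT h₁ h₃

lemma monotone (h : P ≤ Q) : Envelope P ≤ Envelope Q := by
  intro X hX
  induction hX with
  | of X hX => exact .of _ (h _ hX)
  | ext T hT _ _ h₁ h₃ => exact .ext T hT h₁ h₃

lemma shift {n : ℤ} (h : ∀ X, P X → Q (X⟦n⟧)) {X : C} (hX : Envelope P X) :
    Envelope Q (X⟦n⟧) := by
  induction hX with
  | of X hX => exact .of _ (h _ hX)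
  | ext T hT _ _ h₁ h₃ => exact .ext _ (Triangle.shift_distinguished T hT n) h₁ h₃

lemma extensionProduct_le : extensionProduct (Envelope P) (Envelope P) ≤ Envelope P := by
  rintro X ⟨Y, Z, f, g, h, hT, hY, hZ⟩
  exact .ext (Triangle.mk f g h) hT hY hZ

/-- Orthogonality passes to envelopes. -/
lemma hom_eq_zero (h : ∀ X Y, P X → Q Y → ∀ f : X ⟶ Y, f = 0) {X Y : C}
    (hX : Envelope P X) (hY : Envelope Q Y) (f : X ⟶ Y) : f = 0 := by
  induction hX with
  | of X hX =>
    induction hY with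
    | of Y hY => exact h _ _ hX hY f
    | ext T hT _ _ h₁ h₃ =>
      obtain ⟨g, rfl⟩ := T.coyoneda_exact₂ hT f (h₃ _)
      rw [h₁ g, zero_comp]
  | ext T hT _ _ h₁ h₃ =>
    obtain ⟨g, rfl⟩ := T.yoneda_exact₂ hT f (h₁ _)
    rw [h₃ g, comp_zero]

section

variable [IsTriangulated C]

/-- If every extension of an object of `P` by an object of `Q` can be rewritten with the object of
`P` as the first term, then the same holds for the envelope of `Q`. -/
lemma extensionProduct_envelope_left_le (h : extensionProduct Q P ≤ extensionProduct P Q) :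
    extensionProduct (Envelope Q) P ≤ extensionProduct P (Envelope Q) := by
  have key : ∀ X, Envelope Q X → extensionProduct (singleton X) P ≤
      extensionProduct P (Envelope Q) := by
    intro X hX
    induction hX with
    | of X hX =>
      refine (monotone_extensionProduct_left P ?_).trans
        (h.trans (monotone_extensionProduct_right P (le_envelope Q)))
      simpa using hX
    | ext T hT _ _ h₁ h₃ =>
      have hs : singleton T.obj₂ ≤ extensionProduct (singleton T.obj₁) (singleton T.obj₃) := by
        simp only [singleton_le_iff]
        exact ⟨_, _, T.mor₁, T.mor₂, T.mor₃, hT, by simp, by simp⟩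
      refine (monotone_extensionProduct_left P hs).trans ?_
      rw [extensionProduct_assoc]
      refine (monotone_extensionProduct_right _ h₃).trans ?_
      rw [← extensionProduct_assoc]
      refine (monotone_extensionProduct_left _ h₁).trans ?_
      rw [extensionProduct_assoc]
      exact monotone_extensionProduct_right _ extensionProduct_le
  rintro X ⟨Y, Z, f, g, h, hT, hY, hZ⟩
  exact key Y hY X ⟨Y, Z, f, g, h, hT, by simp, hZ⟩

lemma extensionProduct_envelope_le (h : extensionProduct Q P ≤ extensionProduct P Q) :
    extensionProduct (Envelope Q) (Envelope P) ≤
      extensionProduct (Envelope P) (Envelope Q) := by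
  have key : ∀ X, Envelope P X → extensionProduct (Envelope Q) (singleton X) ≤
      extensionProduct (Envelope P) (Envelope Q) := by
    intro X hX
    induction hX with
    | of X hX =>
      refine (monotone_extensionProduct_right _ ?_).trans
        ((extensionProduct_envelope_left_le h).trans
          (monotone_extensionProduct_left _ (le_envelope P)))
      simpa using hX
    | ext T hT _ _ h₁ h₃ =>
      have hs : singleton T.obj₂ ≤ extensionProduct (singleton T.obj₁) (singleton T.obj₃) := by
        simp only [singleton_le_iff]
        exact ⟨_, _, T.mor₁, T.mor₂, T.mor₃, hT, by simp, by simp⟩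
      refine (monotone_extensionProduct_right _ hs).trans ?_
      rw [← extensionProduct_assoc]
      refine (monotone_extensionProduct_left _ h₁).trans ?_
      rw [extensionProduct_assoc]
      refine (monotone_extensionProduct_right _ h₃).trans ?_
      rw [← extensionProduct_assoc]
      exact monotone_extensionProduct_left _ extensionProduct_le
  rintro X ⟨Y, Z, f, g, h, hT, hY, hZ⟩
  exact key Z hZ X ⟨Y, Z, f, g, h, hT, hY, by simp⟩

/-- Sorting of iterated extensions: if extensions of objects of `P` by objects of `Q` can be
rewritten with the term from `P` first, then every iterated extension of objects of `P` and `Q` is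
an extension of an object of the envelope of `Q` by an object of the envelope of `P`. -/
lemma envelope_sup_le [P.ContainsZero] [Q.ContainsZero]
    (h : extensionProduct Q P ≤ extensionProduct P Q) :
    Envelope (P ⊔ Q) ≤ extensionProduct (Envelope P) (Envelope Q) := by
  have : (extensionProduct (Envelope P) (Envelope Q)).IsTriangulatedClosed₂ := by
    refine .mk' fun T hT h₁ h₃ => ?_
    have h' : extensionProduct (extensionProduct (Envelope P) (Envelope Q))
        (extensionProduct (Envelope P) (Envelope Q)) ≤
        extensionProduct (Envelope P) (Envelope Q) := by
      rw [extensionProduct_assoc, ← extensionProduct_assoc (Envelope Q)]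
      refine (monotone_extensionProduct_right _ (monotone_extensionProduct_left _
        (extensionProduct_envelope_le h))).trans ?_
      rw [extensionProduct_assoc, ← extensionProduct_assoc (Envelope P)]
      exact (monotone_extensionProduct_left _ extensionProduct_le).trans
        (monotone_extensionProduct_right _ extensionProduct_le)
    exact h' _ ⟨_, _, T.mor₁, T.mor₂, T.mor₃, hT, h₁, h₃⟩
  exact le_of_le (sup_le ((le_envelope P).trans (le_extensionProduct_left _))
    ((le_envelope Q).trans (le_extensionProduct_right _)))

end

end Envelope

/-- A triangle whose connecting morphism vanishes splits, so its outer terms can be exchanged. -/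
lemma extensionProduct_of_mor₃_eq_zero {P Q : ObjectProperty C} (T : Triangle C)
    (hT : T ∈ distTriang C) (h : T.mor₃ = 0) (h₁ : Q T.obj₁) (h₃ : P T.obj₃) :
    extensionProduct P Q T.obj₂ := by
  obtain ⟨e, -, -⟩ := exists_iso_binaryBiproduct_of_distTriang T hT h
  refine (extensionProduct P Q).prop_of_iso (biprod.braiding _ _ ≪≫ e.symm)
    ⟨T.obj₃, T.obj₁, _, _, _, binaryBiproductTriangle_distinguished _ _, h₃, h₁⟩

end Envelopes

/-! ### Shifts of the members of a family -/

section

variable {C : Type u} [Category.{v} C] [HasShift C ℤ]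

lemma prop_shift_shift_iff (P : ObjectProperty C) [P.IsClosedUnderIsomorphisms] {a b c : ℤ}
    (h : a + b = c) (X : C) : P (X⟦a⟧⟦b⟧) ↔ P (X⟦c⟧) :=
  (P.prop_iff_of_iso ((shiftFunctorAdd' C a b c h).app X)).symm

lemma shift_hom_eq_zero [Preadditive C] [∀ n : ℤ, (shiftFunctor C n).Additive]
    {X Y : C} {a b c : ℤ} (h : a + b = c)
    (hXY : ∀ g : X ⟶ Y⟦a⟧, g = 0) (f : X⟦b⟧ ⟶ Y⟦c⟧) : f = 0 := by
  have e := (shiftFunctorAdd' C a b c h).app Y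
  obtain ⟨g, hg⟩ := (shiftFunctor C b).map_surjective (f ≫ e.hom)
  rw [hXY g, Functor.map_zero] at hg
  rw [← cancel_mono e.hom, ← hg, zero_comp]

/-- The objects isomorphic to a shift `Y⟦j⟧` of an object `Y` of `A i`, for `(i, j)` in a given set
of pairs of integers. -/
def shiftsOver (A : ℤ → ObjectProperty C) (S : Set (ℤ × ℤ)) : ObjectProperty C :=
  fun X => ∃ (i j : ℤ) (Y : C), (i, j) ∈ S ∧ A i Y ∧ Nonempty (X ≅ Y⟦j⟧)

variable {A : ℤ → ObjectProperty C}

instance (S : Set (ℤ × ℤ)) : (shiftsOver A S).IsClosedUnderIsomorphisms where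
  of_iso := by
    rintro X X' e ⟨i, j, Y, hS, hY, ⟨e'⟩⟩
    exact ⟨i, j, Y, hS, hY, ⟨e.symm ≪≫ e'⟩⟩

instance (J : Set ℤ) : (shiftsIn A J).IsClosedUnderIsomorphisms :=
  inferInstanceAs (shiftsOver A {p | p.2 ∈ J}).IsClosedUnderIsomorphisms

lemma shiftsOver_mono {S S' : Set (ℤ × ℤ)} (h : S ⊆ S') : shiftsOver A S ≤ shiftsOver A S' := by
  rintro X ⟨i, j, Y, hS, hY, e⟩
  exact ⟨i, j, Y, h hS, hY, e⟩

lemma shiftsOver_union (S S' : Set (ℤ × ℤ)) :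
    shiftsOver A (S ∪ S') = shiftsOver A S ⊔ shiftsOver A S' := by
  refine le_antisymm ?_ (sup_le (shiftsOver_mono Set.subset_union_left)
    (shiftsOver_mono Set.subset_union_right))
  rintro X ⟨i, j, Y, hS | hS, hY, e⟩
  · exact Or.inl ⟨i, j, Y, hS, hY, e⟩
  · exact Or.inr ⟨i, j, Y, hS, hY, e⟩

lemma shiftsOver_shift {S S' : Set (ℤ × ℤ)} {n : ℤ} (h : ∀ i j, (i, j) ∈ S → (i, j + n) ∈ S')
    (X : C) (hX : shiftsOver A S X) : shiftsOver A S' (X⟦n⟧) := by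
  obtain ⟨i, j, Y, hS, hY, ⟨e⟩⟩ := hX
  exact ⟨i, j + n, Y, h _ _ hS, hY,
    ⟨(shiftFunctor C n).mapIso e ≪≫ ((shiftFunctorAdd' C j n (j + n) rfl).app Y).symm⟩⟩

lemma IsSemiOrthogonal.hom_eq_zero [Preadditive C]
    [∀ n : ℤ, (shiftFunctor C n).Additive] (hA : IsSemiOrthogonal A) {S S' : Set (ℤ × ℤ)}
    (h : ∀ i j k l, (i, j) ∈ S → (k, l) ∈ S' → l < j ∨ i + j < k + l) (X Y : C)
    (hX : shiftsOver A S X) (hY : shiftsOver A S' Y) (f : X ⟶ Y) : f = 0 := by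
  obtain ⟨i, j, X₀, hS, hX₀, ⟨e⟩⟩ := hX
  obtain ⟨k, l, Y₀, hS', hY₀, ⟨e'⟩⟩ := hY
  have := h i j k l hS hS'
  rw [← cancel_epi e.inv, ← cancel_mono e'.hom, comp_zero, zero_comp]
  exact shift_hom_eq_zero (by lia : (l - j) + j = l)
    (fun g => hA i k (l - j) (by lia) X₀ Y₀ hX₀ hY₀ g) _

end

variable {C : Type u} [Category.{v} C] [HasZeroObject C] [HasShift C ℤ] [Preadditive C]
  [∀ n : ℤ, (shiftFunctor C n).Additive] [Pretriangulated C]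

/-! ### Weight structures -/

namespace WeightStructure

variable (w : WeightStructure C)

instance : w.leZero.IsStableUnderRetracts := w.leZero_retracts

instance : w.geZero.IsStableUnderRetracts := w.geZero_retracts

instance (n : ℤ) : (w.le n).IsStableUnderRetracts where
  of_retract r h := w.leZero.prop_of_retract (r.map (shiftFunctor C (-n))) h

instance (n : ℤ) : (w.ge n).IsStableUnderRetracts where
  of_retract r h := w.geZero.prop_of_retract (r.map (shiftFunctor C (-n))) h

lemma le_shift {n a m : ℤ} (h : n + a = m) {X : C} (hX : w.le n X) : w.le m (X⟦a⟧) :=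
  (prop_shift_shift_iff w.leZero (by lia : a + -m = -n) X).2 hX

lemma ge_shift {n a m : ℤ} (h : n + a = m) {X : C} (hX : w.ge n X) : w.ge m (X⟦a⟧) :=
  (prop_shift_shift_iff w.geZero (by lia : a + -m = -n) X).2 hX

lemma le_zero_iff (X : C) : w.le 0 X ↔ w.leZero X := by
  simpa using! w.leZero.prop_iff_of_iso ((shiftFunctorZero C ℤ).app X)

lemma ge_zero_iff (X : C) : w.ge 0 X ↔ w.geZero X := by
  simpa using! w.geZero.prop_iff_of_iso ((shiftFunctorZero C ℤ).app X)

lemma le_monotone : Monotone w.le :=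
  monotone_int_of_le_succ fun n X hX =>
    (prop_shift_shift_iff w.leZero (by lia : -n + -1 = -(n + 1)) X).1 (w.leZero_shift _ hX)

lemma ge_antitone : Antitone w.ge :=
  antitone_int_of_succ_le fun n X hX =>
    (prop_shift_shift_iff w.geZero (by lia : -(n + 1) + 1 = -n) X).1 (w.geZero_shift _ hX)

lemma hom_eq_zero {i j : ℤ} (hij : i < j) {X Y : C} (hX : w.le i X) (hY : w.ge j Y)
    (f : X ⟶ Y) : f = 0 := by
  have hY' : w.ge (i + 1) Y := w.ge_antitone (by lia) _ hY
  apply (shiftFunctor C (-i)).map_injective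
  have e := (shiftFunctorAdd' C (-(i + 1)) 1 (-i) (by lia)).app Y
  rw [Functor.map_zero, ← cancel_mono e.hom, zero_comp]
  exact w.orthogonal _ _ hX hY' _

lemma exists_weightDecomposition (X : C) (i : ℤ) : ∃ (L R : C) (f : L ⟶ X) (g : X ⟶ R)
    (h : R ⟶ L⟦(1 : ℤ)⟧), IsWeightDecomposition w i (Triangle.mk f g h) := by
  obtain ⟨A, B, f, g, h, hA, hB, hT⟩ := w.exists_decomposition (X⟦-i⟧)
  obtain ⟨f', g', h', hT'⟩ := exists_shift_distinguished hT i
  let e : X⟦-i⟧⟦i⟧ ≅ X := (shiftEquiv C i).counitIso.app X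
  refine ⟨A⟦i⟧, B⟦(1 : ℤ)⟧⟦i⟧, _, _, _,
    distinguished_of_iso hT' (f' := f' ≫ e.hom) (g' := e.inv ≫ g') (Iso.refl _) e (Iso.refl _)
      (by simp) (by simp) (h' := h') (by simp), ?_, ?_⟩
  · exact w.le_shift (by lia : (0 : ℤ) + i = i) ((w.le_zero_iff A).2 hA)
  · exact w.ge_shift (by lia : (1 : ℤ) + i = i + 1)
      (w.ge_shift (by lia : (0 : ℤ) + 1 = 1) ((w.ge_zero_iff B).2 hB))

/-- The class `C^{w ≤ i}` is the left orthogonal of `C^{w ≥ i + 1}`. -/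
lemma le_iff_orthogonal (i : ℤ) (X : C) :
    w.le i X ↔ ∀ (Y : C) (_ : w.ge (i + 1) Y) (f : X ⟶ Y), f = 0 := by
  refine ⟨fun hX Y hY f => w.hom_eq_zero (by lia) hX hY f, fun H => ?_⟩
  obtain ⟨L, R, f, g, h, hT⟩ := w.exists_weightDecomposition X i
  obtain ⟨s, hs⟩ := exists_lift₂ hT.distinguished (𝟙 X) (by rw [H R hT.ge g, comp_zero])
  exact (w.le i).prop_of_retract ⟨s, f, hs.symm⟩ hT.le

/-- The class `C^{w ≥ i + 1}` is the right orthogonal of `C^{w ≤ i}`. -/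
lemma ge_iff_orthogonal (i : ℤ) (Y : C) :
    w.ge (i + 1) Y ↔ ∀ (X : C) (_ : w.le i X) (f : X ⟶ Y), f = 0 := by
  refine ⟨fun hY X hX f => w.hom_eq_zero (by lia) hX hY f, fun H => ?_⟩
  obtain ⟨L, R, f, g, h, hT⟩ := w.exists_weightDecomposition Y i
  obtain ⟨s, hs⟩ := exists_desc₂ hT.distinguished (𝟙 Y) (by rw [H L hT.le f, zero_comp])
  exact (w.ge (i + 1)).prop_of_retract ⟨g, s, hs.symm⟩ hT.ge

instance (i : ℤ) : (w.le i).IsTriangulatedClosed₂ :=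
  .mk' fun T hT h₁ h₃ => by
    rw [w.le_iff_orthogonal] at h₁ h₃ ⊢
    intro Y hY f
    obtain ⟨g, rfl⟩ := T.yoneda_exact₂ hT f (h₁ _ hY _)
    rw [h₃ _ hY g, comp_zero]

instance (i : ℤ) : (w.ge i).IsTriangulatedClosed₂ :=
  .mk' fun T hT h₁ h₃ => by
    obtain ⟨i, rfl⟩ : ∃ k, i = k + 1 := ⟨i - 1, by lia⟩
    rw [w.ge_iff_orthogonal] at h₁ h₃ ⊢
    intro Y hY f
    obtain ⟨g, rfl⟩ := T.coyoneda_exact₂ hT f (h₃ _ hY _)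
    rw [h₁ _ hY g, zero_comp]

lemma le_of_isZero {X : C} (hX : IsZero X) (i : ℤ) : w.le i X :=
  (w.le_iff_orthogonal i X).2 fun _ _ _ => hX.eq_of_src _ _

lemma ge_of_isZero {X : C} (hX : IsZero X) (i : ℤ) : w.ge i X := by
  obtain ⟨i, rfl⟩ : ∃ k, i = k + 1 := ⟨i - 1, by lia⟩
  exact (w.ge_iff_orthogonal i X).2 fun _ _ _ => hX.eq_of_tgt _ _

instance (i : ℤ) : (w.le i).ContainsZero :=
  ⟨_, isZero_zero C, w.le_of_isZero (isZero_zero C) i⟩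

end WeightStructure

/-! ### The weight structure of a semi-orthogonal family -/

section

variable {A : ℤ → ObjectProperty C}

lemma IsAdditiveFamily.containsZero (hA : IsAdditiveFamily A) (i : ℤ) : (A i).ContainsZero :=
  have := hA.isClosedUnderFiniteProducts i
  containsZero_of_isClosedUnderFiniteProducts (A i)

lemma IsAdditiveFamily.shiftsOver_containsZero (hA : IsAdditiveFamily A) {S : Set (ℤ × ℤ)}
    (hS : S.Nonempty) : (shiftsOver A S).ContainsZero where
  exists_zero := by
    obtain ⟨⟨i, j⟩, hij⟩ := hS
    have := hA.containsZero i
    obtain ⟨Z, hZ, h⟩ := (A i).exists_prop_of_containsZero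
    exact ⟨Z⟦j⟧, Functor.map_isZero _ hZ, i, j, Z, hij, h, ⟨Iso.refl _⟩⟩

lemma IsSemiOrthogonal.envelope_hom_eq_zero (hA : IsSemiOrthogonal A) {S S' : Set (ℤ × ℤ)}
    (h : ∀ i j k l, (i, j) ∈ S → (k, l) ∈ S' → l < j ∨ i + j < k + l) {X Y : C}
    (hX : Envelope (shiftsOver A S) X) (hY : Envelope (shiftsOver A S') Y) (f : X ⟶ Y) : f = 0 :=
  Envelope.hom_eq_zero (hA.hom_eq_zero h) hX hY f

/-- Iterated extensions of shifts `Y⟦j⟧`, `Y ∈ A i`, `j ∈ J`, can be sorted by the weight `i + j`: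
a connecting morphism from an object of smaller weight to the shift by `1` of an object of larger
weight vanishes by semi-orthogonality. -/
lemma IsSemiOrthogonal.envelope_le_extensionProduct [IsTriangulated C] (hA : IsSemiOrthogonal A)
    (hA' : IsAdditiveFamily A) {J : Set ℤ} (hJ : J.Nonempty) (m : ℤ) :
    Envelope (shiftsIn A J) ≤ extensionProduct
      (Envelope (shiftsOver A {p | p.2 ∈ J ∧ p.1 + p.2 ≤ m}))
      (Envelope (shiftsOver A {p | p.2 ∈ J ∧ m + 1 ≤ p.1 + p.2})) := by
  obtain ⟨j, hj⟩ := hJ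
  have := hA'.shiftsOver_containsZero (S := {p | p.2 ∈ J ∧ p.1 + p.2 ≤ m})
    ⟨(m - j, j), hj, by dsimp; lia⟩
  have := hA'.shiftsOver_containsZero (S := {p | p.2 ∈ J ∧ m + 1 ≤ p.1 + p.2})
    ⟨(m + 1 - j, j), hj, by dsimp; lia⟩
  refine le_trans (Envelope.monotone ?_) (Envelope.envelope_sup_le ?_)
  · rw [← shiftsOver_union]
    refine shiftsOver_mono (S := {p | p.2 ∈ J}) ?_
    rintro ⟨i, j⟩ (hj : j ∈ J)
    rcases le_or_gt (i + j) m with h | h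
    · exact Or.inl ⟨hj, h⟩
    · exact Or.inr ⟨hj, by dsimp; lia⟩
  · rintro Y ⟨X, Z, f, g, h, hT, hX, hZ⟩
    refine extensionProduct_of_mor₃_eq_zero (Triangle.mk f g h) hT ?_ hX hZ
    refine hA.hom_eq_zero (S' := {p | m + 2 ≤ p.1 + p.2}) ?_ _ _ hZ
      (shiftsOver_shift (n := 1) ?_ _ hX) h
    · rintro i j k l ⟨-, h₁⟩ h₂
      right
      dsimp at h₁ h₂
      lia
    · rintro i j ⟨-, h⟩
      dsimp at h ⊢
      lia

lemma IsGenerating.envelope (hA : IsAdditiveFamily A) (h : IsGenerating A) (X : C) :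
    Envelope (shiftsIn A Set.univ) X := by
  have hz : (shiftsIn A Set.univ).ContainsZero :=
    hA.shiftsOver_containsZero (S := {p | p.2 ∈ Set.univ}) ⟨(0, 0), trivial⟩
  have hs : (Envelope (shiftsIn A Set.univ)).IsStableUnderShift ℤ :=
    ⟨fun n => ⟨fun X hX => hX.shift (Q := shiftsIn A Set.univ)
      (shiftsOver_shift (S := {p | p.2 ∈ Set.univ}) (S' := {p | p.2 ∈ Set.univ})
        (fun _ _ _ => trivial))⟩⟩
  refine h _ ObjectProperty.IsTriangulated.mk inferInstance
    (fun i Y hY => .of _ ⟨i, 0, Y, trivial, hY, ⟨?_⟩⟩) X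
  exact ((shiftFunctorZero C ℤ).app Y).symm

/-- A semi-orthogonal family whose shifts generate `C` by extensions gives a weight structure, for
which the objects of `A i` have weight `i`. -/
def IsSemiOrthogonal.weightStructure [IsTriangulated C] (hA : IsSemiOrthogonal A)
    (hA' : IsAdditiveFamily A) (h : ∀ X, Envelope (shiftsIn A Set.univ) X) :
    WeightStructure C where
  leZero := (Envelope (shiftsOver A {p | p.1 + p.2 ≤ 0})).retractClosure
  geZero := (Envelope (shiftsOver A {p | 0 ≤ p.1 + p.2})).retractClosure
  leZero_finiteProducts := by
    have := hA'.shiftsOver_containsZero (S := {p | p.1 + p.2 ≤ 0}) ⟨(0, 0), by simp⟩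
    exact isClosedUnderFiniteProducts_of_isTriangulatedClosed₂ _
  geZero_finiteProducts := by
    have := hA'.shiftsOver_containsZero (S := {p | 0 ≤ p.1 + p.2}) ⟨(0, 0), by simp⟩
    exact isClosedUnderFiniteProducts_of_isTriangulatedClosed₂ _
  leZero_retracts := inferInstance
  geZero_retracts := inferInstance
  leZero_shift := by
    rintro X ⟨Y, hY, ⟨r⟩⟩
    refine ⟨Y⟦(-1 : ℤ)⟧, hY.shift (shiftsOver_shift ?_), ⟨r.map _⟩⟩
    intro i j hij
    dsimp at hij ⊢
    lia
  geZero_shift := by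
    rintro X ⟨Y, hY, ⟨r⟩⟩
    refine ⟨Y⟦(1 : ℤ)⟧, hY.shift (shiftsOver_shift ?_), ⟨r.map _⟩⟩
    intro i j hij
    dsimp at hij ⊢
    lia
  orthogonal := by
    rintro X Y ⟨X', hX', ⟨r⟩⟩ ⟨Y', hY', ⟨s⟩⟩ f
    have h₁ : Envelope (shiftsOver A {p | 1 ≤ p.1 + p.2}) (Y'⟦(1 : ℤ)⟧) :=
      hY'.shift (shiftsOver_shift (fun i j hij => by dsimp at hij ⊢; lia))
    have h₂ : r.r ≫ f ≫ s.i⟦1⟧' = 0 :=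
      hA.envelope_hom_eq_zero (fun i j k l h h' => by dsimp at h h'; lia) hX' h₁ _
    have : s.i⟦(1 : ℤ)⟧' ≫ s.r⟦(1 : ℤ)⟧' = 𝟙 _ := by
      rw [← Functor.map_comp, s.retract, CategoryTheory.Functor.map_id]
    calc f = r.i ≫ (r.r ≫ f ≫ s.i⟦1⟧') ≫ s.r⟦1⟧' := by simp [this]
      _ = 0 := by rw [h₂, zero_comp, comp_zero]
  exists_decomposition X := by
    obtain ⟨L, R, f, g, k, hT, hL, hR⟩ :=
      hA.envelope_le_extensionProduct hA' Set.univ_nonempty 0 X (h X)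
    let e : R ≅ R⟦(-1 : ℤ)⟧⟦(1 : ℤ)⟧ := (shiftEquiv C (1 : ℤ)).counitIso.symm.app R
    refine ⟨L, R⟦(-1 : ℤ)⟧, f, g ≫ e.hom, e.inv ≫ k, ?_, ?_,
      distinguished_of_iso hT (Iso.refl _) (Iso.refl _) e (by simp) (by simp) (by simp)⟩
    · exact le_retractClosure _ _ (Envelope.monotone (shiftsOver_mono (fun p hp => hp.2)) _ hL)
    · refine le_retractClosure _ _ (hR.shift (shiftsOver_shift ?_))
      rintro i j ⟨-, hij⟩
      dsimp at hij ⊢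
      lia

section

variable [IsTriangulated C] (hA : IsSemiOrthogonal A) (hA' : IsAdditiveFamily A)
  (h : ∀ X, Envelope (shiftsIn A Set.univ) X)

lemma IsSemiOrthogonal.weightStructure_le {S : Set (ℤ × ℤ)} {m : ℤ}
    (hS : ∀ i j, (i, j) ∈ S → i + j ≤ m) :
    Envelope (shiftsOver A S) ≤ (hA.weightStructure hA' h).le m := fun _ hX =>
  le_retractClosure _ _ (hX.shift (shiftsOver_shift fun i j hij => by
    have := hS i j hij
    dsimp
    lia))

lemma IsSemiOrthogonal.weightStructure_ge {S : Set (ℤ × ℤ)} {m : ℤ}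
    (hS : ∀ i j, (i, j) ∈ S → m ≤ i + j) :
    Envelope (shiftsOver A S) ≤ (hA.weightStructure hA' h).ge m := fun _ hX =>
  le_retractClosure _ _ (hX.shift (shiftsOver_shift fun i j hij => by
    have := hS i j hij
    dsimp
    lia))

lemma IsSemiOrthogonal.weightStructure_isBounded :
    (hA.weightStructure hA' h).IsBounded := by
  intro X
  induction h X with
  | of X hX =>
    obtain ⟨i, j, Y, -, hY, e⟩ := hX
    have hX' : shiftsOver A {(i, j)} X := ⟨i, j, Y, rfl, hY, e⟩
    exact ⟨i + j, i + j, hA.weightStructure_ge hA' h (by rintro _ _ ⟨⟩; rfl) _ (.of _ hX'),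
      hA.weightStructure_le hA' h (by rintro _ _ ⟨⟩; rfl) _ (.of _ hX')⟩
  | ext T hT _ _ h₁ h₃ =>
    obtain ⟨a, b, ha, hb⟩ := h₁
    obtain ⟨a', b', ha', hb'⟩ := h₃
    set w := hA.weightStructure hA' h
    exact ⟨min a a', max b b', (w.ge _).ext_of_isTriangulatedClosed₂ T hT
        (w.ge_antitone (min_le_left _ _) _ ha) (w.ge_antitone (min_le_right _ _) _ ha'),
      (w.le _).ext_of_isTriangulatedClosed₂ T hT
        (w.le_monotone (le_max_left _ _) _ hb) (w.le_monotone (le_max_right _ _) _ hb')⟩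

end

end

/-! ### Torsion pairs with vanishing extensions in abelian categories -/

section TorsionPair

variable {𝓐 : Type u} [Category.{v} 𝓐] [Abelian 𝓐]

/-- A functor is additive if it is objectwise a subfunctor of the identity. -/
lemma additive_of_mono (L : 𝓐 ⥤ 𝓐) (ι : ∀ X, L.obj X ⟶ X) [∀ X, Mono (ι X)]
    (nat : ∀ ⦃X Y : 𝓐⦄ (f : X ⟶ Y), L.map f ≫ ι Y = ι X ≫ f) : L.Additive where
  map_add {X Y f g} := by
    rw [← cancel_mono (ι Y), Preadditive.add_comp, nat, nat, nat, Preadditive.comp_add]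

/-- A functor is additive if it is objectwise a quotient of the identity. -/
lemma additive_of_epi (R : 𝓐 ⥤ 𝓐) (π : ∀ X, X ⟶ R.obj X) [∀ X, Epi (π X)]
    (nat : ∀ ⦃X Y : 𝓐⦄ (f : X ⟶ Y), f ≫ π Y = π X ≫ R.map f) : R.Additive where
  map_add {X Y f g} := by
    rw [← cancel_epi (π X), Preadditive.comp_add, ← nat, ← nat, ← nat, Preadditive.add_comp]

/-- A torsion pair `(P, Q)` in an abelian category (`P` is the torsion class) such that extensions
of torsion objects by torsion-free objects split. -/
structure IsSplitTorsionPair (P Q : ObjectProperty 𝓐) : Prop where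
  isClosedUnderIsomorphisms_left : P.IsClosedUnderIsomorphisms
  isClosedUnderIsomorphisms_right : Q.IsClosedUnderIsomorphisms
  hom_eq_zero : ∀ ⦃X Y : 𝓐⦄, P X → Q Y → ∀ f : X ⟶ Y, f = 0
  exists_shortExact : ∀ X : 𝓐, ∃ (L R : 𝓐) (f : L ⟶ X) (g : X ⟶ R) (w : f ≫ g = 0),
    (ShortComplex.mk f g w).ShortExact ∧ P L ∧ Q R
  splits : ∀ S : ShortComplex 𝓐, S.ShortExact → Q S.X₁ → P S.X₃ → Nonempty S.Splitting

namespace IsSplitTorsionPair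

variable {P Q : ObjectProperty 𝓐} (h : IsSplitTorsionPair P Q)

include h

lemma isZero {X : 𝓐} (hP : P X) (hQ : Q X) : IsZero X :=
  (IsZero.iff_id_eq_zero X).2 (h.hom_eq_zero hP hQ _)

lemma left_of_epi {X Y : 𝓐} (f : X ⟶ Y) [Epi f] (hX : P X) : P Y := by
  obtain ⟨L, R, i, p, w, hS, hL, hR⟩ := h.exists_shortExact Y
  have := hS.epi_g
  have := hS.mono_f
  have hp : p = 0 := by rw [← cancel_epi f, comp_zero, h.hom_eq_zero hX hR (f ≫ p)]
  have : Epi i := hS.exact.epi_f hp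
  have : IsIso i := isIso_of_mono_of_epi i
  have := h.isClosedUnderIsomorphisms_left
  exact P.prop_of_iso (asIso i) hL

lemma right_of_mono {X Y : 𝓐} (f : X ⟶ Y) [Mono f] (hY : Q Y) : Q X := by
  obtain ⟨L, R, i, p, w, hS, hL, hR⟩ := h.exists_shortExact X
  have := hS.epi_g
  have := hS.mono_f
  have hi : i = 0 := by rw [← cancel_mono f, zero_comp, h.hom_eq_zero hL hY (i ≫ f)]
  have : Mono p := hS.exact.mono_g hi
  have : IsIso p := isIso_of_mono_of_epi p
  have := h.isClosedUnderIsomorphisms_right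
  exact Q.prop_of_iso (asIso p).symm hR

/-- Torsion classes of this kind are closed under subobjects: if `X ⟶ Y` is a monomorphism with `Y`
torsion, and `R` is the torsion-free quotient of `X`, then the pushout of `Y` along `X ⟶ R` is a
torsion object which contains `R` as a direct summand, so that `R = 0`. -/
lemma left_of_mono {X Y : 𝓐} (f : X ⟶ Y) [Mono f] (hY : P Y) : P X := by
  obtain ⟨L, R, i, p, w, hS, hL, hR⟩ := h.exists_shortExact X
  have := hS.epi_g
  have := hS.mono_f
  have : Epi p := hS.epi_g
  let r : R ⟶ pushout f p := pushout.inr f p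
  have hP : P (pushout f p) := h.left_of_epi (pushout.inl f p) hY
  let S := ShortComplex.mk r (cokernel.π r) (by simp)
  obtain ⟨s⟩ := h.splits S ⟨ShortComplex.exact_cokernel r⟩ hR (h.left_of_epi (cokernel.π r) hP)
  have hp : p = 0 := by
    have : (𝟙 R : R ⟶ R) = 0 := by
      rw [← s.f_r, h.hom_eq_zero hP hR s.r, comp_zero]
    rw [← Category.comp_id p, this, comp_zero]
  have : Epi i := hS.exact.epi_f hp
  have : IsIso i := isIso_of_mono_of_epi i
  have := h.isClosedUnderIsomorphisms_left
  exact P.prop_of_iso (asIso i) hL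

lemma right_of_epi {X Y : 𝓐} (f : X ⟶ Y) [Epi f] (hX : Q X) : Q Y := by
  obtain ⟨L, R, i, p, w, hS, hL, hR⟩ := h.exists_shortExact Y
  have := hS.epi_g
  have := hS.mono_f
  have : Mono i := hS.mono_f
  let r : pullback f i ⟶ L := pullback.snd f i
  have hQ : Q (pullback f i) := h.right_of_mono (pullback.fst f i) hX
  let S := ShortComplex.mk (kernel.ι r) r (by simp)
  obtain ⟨s⟩ := h.splits S ⟨ShortComplex.exact_kernel r⟩ (h.right_of_mono (kernel.ι r) hQ) hL
  have hi : i = 0 := by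
    have : (𝟙 L : L ⟶ L) = 0 := by
      rw [← s.s_g, h.hom_eq_zero hL hQ s.s, zero_comp]
    rw [← Category.id_comp i, this, zero_comp]
  have : Mono p := hS.exact.mono_g hi
  have : IsIso p := isIso_of_mono_of_epi p
  have := h.isClosedUnderIsomorphisms_right
  exact Q.prop_of_iso (asIso p).symm hR

lemma hom_eq_zero' {X Y : 𝓐} (hX : Q X) (hY : P Y) (f : X ⟶ Y) : f = 0 := by
  have hI : IsZero (image f) :=
    h.isZero (h.left_of_mono (image.ι f) hY) (h.right_of_epi (factorThruImage f) hX)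
  rw [← image.fac f, hI.eq_of_tgt (factorThruImage f) 0, zero_comp]

section Functors

variable (L R : 𝓐 ⥤ 𝓐) (ι : ∀ X, L.obj X ⟶ X) (π : ∀ X, X ⟶ R.obj X)
  (hι : ∀ ⦃X Y : 𝓐⦄ (f : X ⟶ Y), L.map f ≫ ι Y = ι X ≫ f)
  (hπ : ∀ ⦃X Y : 𝓐⦄ (f : X ⟶ Y), f ≫ π Y = π X ≫ R.map f)
  (w : ∀ X, ι X ≫ π X = 0) (hS : ∀ X, (ShortComplex.mk (ι X) (π X) (w X)).ShortExact)
  (hL : ∀ X, P (L.obj X)) (hR : ∀ X, Q (R.obj X))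

include hι hπ hS hL hR

omit hι in
/-- The kernel of `R X ⟶ R Y` is torsion-free as a subobject of `R X`. It is also torsion, since
its preimage in `X` embeds into `L Y`. -/
lemma mono_right_map {X Y : 𝓐} (f : X ⟶ Y) [Mono f] : Mono (R.map f) := by
  have : Epi (π X) := (hS X).epi_g
  have : Mono (ι Y) := (hS Y).mono_f
  let k := kernel.ι (R.map f)
  let m : pullback (π X) k ⟶ X := pullback.fst _ _
  let p : pullback (π X) k ⟶ kernel (R.map f) := pullback.snd _ _
  have hm : (m ≫ f) ≫ π Y = 0 := by
    rw [Category.assoc, hπ, pullback.condition_assoc, kernel.condition, comp_zero]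
  obtain ⟨l, hl⟩ := (hS Y).exact.lift' (m ≫ f) hm
  have hl : l ≫ ι Y = m ≫ f := hl
  have : Mono l := by
    have : Mono (l ≫ ι Y) := by rw [hl]; infer_instance
    exact mono_of_mono l (ι Y)
  have hK : IsZero (kernel (R.map f)) :=
    h.isZero (h.left_of_epi p (h.left_of_mono l (hL Y))) (h.right_of_mono k (hR X))
  exact Preadditive.mono_of_kernel_zero (hK.eq_of_src _ _)

omit hπ in
lemma epi_left_map {X Y : 𝓐} (f : X ⟶ Y) [Epi f] : Epi (L.map f) := by
  have : Epi (π X) := (hS X).epi_g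
  have : Mono (ι Y) := (hS Y).mono_f
  let k := cokernel.π (L.map f)
  let m : Y ⟶ pushout (ι Y) k := pushout.inl _ _
  let p : cokernel (L.map f) ⟶ pushout (ι Y) k := pushout.inr _ _
  have hm : ι X ≫ f ≫ m = 0 := by
    rw [← reassoc_of% hι f, pushout.condition, cokernel.condition_assoc, zero_comp]
  obtain ⟨l, hl⟩ := (hS X).exact.desc' (f ≫ m) hm
  have hl : π X ≫ l = f ≫ m := hl
  have : Epi l := by
    have : Epi (π X ≫ l) := by rw [hl]; infer_instance
    exact epi_of_epi (π X) l
  have hK : IsZero (cokernel (L.map f)) :=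
    h.isZero (h.left_of_epi k (hL Y)) (h.right_of_mono p (h.right_of_epi l (hR X)))
  exact Preadditive.epi_of_cokernel_zero (hK.eq_of_tgt _ _)

/-- The functor sending an object to its torsion part is exact. -/
lemma exact_left : PreservesFiniteLimits L ∧ PreservesFiniteColimits L := by
  have (X : 𝓐) : Mono (ι X) := (hS X).mono_f
  have := additive_of_mono L ι hι
  refine ((Functor.exact_tfae L).out 0 3).1 fun S hS' => ?_
  have := hS'.mono_f
  have := hS'.epi_g
  have : Mono (L.map S.f) := by
    have : Mono (L.map S.f ≫ ι S.X₂) := by rw [hι]; infer_instance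
    exact mono_of_mono _ (ι S.X₂)
  have := h.epi_left_map L R ι π hι w hS hL hR S.g
  have := h.mono_right_map L R ι π hπ w hS hL hR S.f
  have key {T : 𝓐} (k : T ⟶ L.obj S.X₂) (hk : k ≫ L.map S.g = 0) :
      ∃ l : T ⟶ L.obj S.X₁, l ≫ L.map S.f = k := by
    obtain ⟨a, ha⟩ := hS'.exact.lift' (k ≫ ι S.X₂)
      (by rw [Category.assoc, ← hι, reassoc_of% hk, zero_comp])
    obtain ⟨l, hl⟩ := (hS S.X₁).exact.lift' a
      (by dsimp; rw [← cancel_mono (R.map S.f), zero_comp, Category.assoc, ← hπ, reassoc_of% ha,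
        w, comp_zero])
    dsimp at hl
    exact ⟨l, by rw [← cancel_mono (ι S.X₂), Category.assoc, hι, reassoc_of% hl, ha]⟩
  have : Mono (S.map L).f := ‹Mono (L.map S.f)›
  refine .mk' ?_ this ‹Epi (L.map S.g)›
  exact ShortComplex.exact_of_f_is_kernel _ (KernelFork.IsLimit.ofι' _ _ fun {T} k hk =>
    ⟨(key k hk).choose, (key k hk).choose_spec⟩)

/-- The functor sending an object to its torsion-free quotient is exact. -/
lemma exact_right : PreservesFiniteLimits R ∧ PreservesFiniteColimits R := by
  have (X : 𝓐) : Epi (π X) := (hS X).epi_g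
  have := additive_of_epi R π hπ
  refine ((Functor.exact_tfae R).out 0 3).1 fun S hS' => ?_
  have := hS'.mono_f
  have := hS'.epi_g
  have : Epi (R.map S.g) := by
    have : Epi (π S.X₂ ≫ R.map S.g) := by rw [← hπ]; infer_instance
    exact epi_of_epi (π S.X₂) _
  have := h.epi_left_map L R ι π hι w hS hL hR S.g
  have := h.mono_right_map L R ι π hπ w hS hL hR S.f
  have key {T : 𝓐} (k : R.obj S.X₂ ⟶ T) (hk : R.map S.f ≫ k = 0) :
      ∃ l : R.obj S.X₃ ⟶ T, R.map S.g ≫ l = k := by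
    obtain ⟨a, ha⟩ := hS'.exact.desc' (π S.X₂ ≫ k)
      (by rw [reassoc_of% hπ S.f, hk, comp_zero])
    obtain ⟨l, hl⟩ := (hS S.X₃).exact.desc' a
      (by dsimp; rw [← cancel_epi (L.map S.g), comp_zero, reassoc_of% hι S.g, ha, reassoc_of% w,
        zero_comp])
    dsimp at hl
    exact ⟨l, by rw [← cancel_epi (π S.X₂), ← reassoc_of% hπ S.g, hl, ha]⟩
  have : Epi (S.map R).g := ‹Epi (R.map S.g)›
  refine .mk' ?_ ‹Mono (R.map S.f)› this
  exact ShortComplex.exact_of_g_is_cokernel _ (CokernelCofork.IsColimit.ofπ' _ _ fun {T} k hk =>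
    ⟨(key k hk).choose, (key k hk).choose_spec⟩)

end Functors

end IsSplitTorsionPair

end TorsionPair

/-! ### The heart of a t-structure -/

section Heart

variable {C : Type u} [Category.{v} C] [HasZeroObject C] [HasShift C ℤ] [Preadditive C]
  [∀ n : ℤ, (shiftFunctor C n).Additive] [Pretriangulated C] (t : TStructure C)

lemma isLE_of_isZero {X : C} (hX : IsZero X) (n : ℤ) : t.IsLE X n :=
  (t.isLE_iff_orthogonal n (n + 1) rfl X).2 fun _ _ _ => hX.eq_of_src _ _

lemma isGE_of_isZero {X : C} (hX : IsZero X) (n : ℤ) : t.IsGE X n :=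
  (t.isGE_iff_orthogonal (n - 1) n (by lia) X).2 fun _ _ _ => hX.eq_of_tgt _ _

instance heart_containsZero : t.heart.ContainsZero where
  exists_zero := ⟨_, isZero_zero C, (t.mem_heart_iff _).2
    ⟨isLE_of_isZero t (isZero_zero C) 0, isGE_of_isZero t (isZero_zero C) 0⟩⟩

instance heart_isTriangulatedClosed₂ : t.heart.IsTriangulatedClosed₂ :=
  .mk' fun T hT h₁ h₃ => by
    rw [t.mem_heart_iff] at h₁ h₃ ⊢
    exact ⟨t.isLE₂ T hT 0 h₁.1 h₃.1, t.isGE₂ T hT 0 h₁.2 h₃.2⟩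

instance heart_isClosedUnderFiniteProducts : t.heart.IsClosedUnderFiniteProducts :=
  isClosedUnderFiniteProducts_of_isTriangulatedClosed₂ _

variable {t}

lemma heart_hom_shift_eq_zero {X Y : C} (hX : t.heart X) (hY : t.heart Y) {n : ℤ} (hn : n < 0)
    (f : X ⟶ Y⟦n⟧) : f = 0 := by
  have := ((t.mem_heart_iff X).1 hX).1
  have := ((t.mem_heart_iff Y).1 hY).2
  have := t.isGE_shift Y 0 n (-n)
  exact t.zero f 0 (-n)

lemma heart_shift_hom_eq_zero {X Y : C} (hX : t.heart X) (hY : t.heart Y) {n : ℤ} (hn : 0 < n)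
    (f : X⟦n⟧ ⟶ Y) : f = 0 := by
  have := ((t.mem_heart_iff X).1 hX).1
  have := ((t.mem_heart_iff Y).1 hY).2
  have := t.isLE_shift X 0 n (-n)
  exact t.zero f (-n) 0

/-- The middle term of a truncation triangle bounds the outer ones. -/
lemma exists_triangle_bounded (X : C) (a b n₀ n₁ : ℤ) (h : n₀ + 1 = n₁) (ha : a ≤ n₁ + 1)
    (hb : n₀ - 1 ≤ b) (hXa : t.IsGE X a) (hXb : t.IsLE X b) :
    ∃ (L R : C) (f : L ⟶ X) (g : X ⟶ R) (δ : R ⟶ L⟦(1 : ℤ)⟧),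
      Triangle.mk f g δ ∈ distTriang C ∧ t.IsLE L n₀ ∧ t.IsGE R n₁ ∧ t.IsGE L a ∧ t.IsLE R b := by
  obtain ⟨L, R, hL, hR, f, g, δ, hT⟩ := t.exists_triangle X n₀ n₁ h
  have hL : t.IsLE L n₀ := ⟨hL⟩
  have hR : t.IsGE R n₁ := ⟨hR⟩
  refine ⟨L, R, f, g, δ, hT, hL, hR, ?_, ?_⟩
  · have := t.isGE_shift R n₁ (-1) (n₁ + 1)
    exact t.isGE₂ _ (inv_rot_of_distTriang _ hT) a (t.isGE_of_ge (R⟦(-1 : ℤ)⟧) a (n₁ + 1)) hXa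
  · have := t.isLE_shift L n₀ 1 (n₀ - 1)
    exact t.isLE₂ _ (rot_of_distTriang _ hT) b hXb (t.isLE_of_le (L⟦(1 : ℤ)⟧) (n₀ - 1) b)

/-- A bounded t-structure generates: an extension-closed class which contains all shifts of the
objects of the heart contains everything. -/
lemma IsBoundedTStructure.induction (ht : IsBoundedTStructure t) (P : ObjectProperty C)
    [P.IsTriangulatedClosed₂] [P.IsClosedUnderIsomorphisms]
    (h : ∀ X (n : ℤ), t.heart X → P (X⟦n⟧)) (X : C) : P X := by
  have key : ∀ (n : ℕ) (a : ℤ) (X : C), t.IsGE X a → t.IsLE X (a + n - 1) → P X := by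
    intro n
    induction n with
    | zero =>
      intro a X h₁ h₂
      have hX : IsZero X := t.isZero X (a + (0 : ℕ) - 1) a
      have hX' := h X 0 ((t.mem_heart_iff X).2 ⟨isLE_of_isZero t hX 0, isGE_of_isZero t hX 0⟩)
      exact P.prop_of_iso ((shiftFunctorZero C ℤ).app X) hX'
    | succ n hn =>
      intro a X h₁ h₂
      push_cast at h₂
      obtain ⟨L, R, f, g, δ, hT, h₃, h₄, h₅, h₆⟩ := exists_triangle_bounded (t := t) X a (a + n)
        (a + n - 1) (a + n) (by lia) (by lia) (by lia) h₁ (t.isLE_of_le X (a + (n + 1) - 1) _)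
      refine P.ext_of_isTriangulatedClosed₂ _ hT (hn a L h₅ h₃) ?_
      have h₇ := t.isGE_shift R (a + n) (a + n) 0
      have h₈ := t.isLE_shift R (a + n) (a + n) 0
      exact P.prop_of_iso ((shiftEquiv C (a + n : ℤ)).unitIso.symm.app R)
        (h (R⟦(a + n : ℤ)⟧) (-(a + n)) ((t.mem_heart_iff _).2 ⟨h₈, h₇⟩))
  obtain ⟨a, b, ha, hb⟩ := ht X
  have ha : t.IsGE X a := ⟨ha⟩
  have hb : t.IsLE X b := ⟨hb⟩
  exact key (b - a + 1).toNat a X ha (t.isLE_of_le X b _)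

/-- The cone `Z` of a morphism `X ⟶ Y` of the heart is an extension of its cokernel by the shift of
its kernel. -/
lemma heart_exists_kernel_cokernel {X Y Z : C} {f : X ⟶ Y} {g : Y ⟶ Z} {δ : Z ⟶ X⟦(1 : ℤ)⟧}
    (hT : Triangle.mk f g δ ∈ distTriang C) (hX : t.heart X) (hY : t.heart Y) :
    ∃ (K Q : C) (α : K⟦(1 : ℤ)⟧ ⟶ Z) (β : Z ⟶ Q) (γ : Q ⟶ K⟦(1 : ℤ)⟧⟦(1 : ℤ)⟧),
      Triangle.mk α β γ ∈ distTriang C ∧ t.heart K ∧ t.heart Q := by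
  obtain ⟨hX₁, hX₂⟩ := (t.mem_heart_iff X).1 hX
  obtain ⟨hY₁, hY₂⟩ := (t.mem_heart_iff Y).1 hY
  have := t.isLE_shift X 0 1 (-1)
  have := t.isGE_shift X 0 1 (-1)
  have h₁ : t.IsGE Z (-1) := t.isGE₂ _ (rot_of_distTriang _ hT) (-1)
    (t.isGE_of_ge Y (-1) 0) ‹t.IsGE (X⟦(1 : ℤ)⟧) (-1)›
  have h₂ : t.IsLE Z 0 := t.isLE₂ _ (rot_of_distTriang _ hT) 0 hY₁ (t.isLE_of_le (X⟦(1 : ℤ)⟧) (-1) 0)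
  obtain ⟨L, R, α, β, γ, hT', h₃, h₄, h₅, h₆⟩ := exists_triangle_bounded (t := t) Z (-1) 0 (-1) 0
    (by lia) (by lia) (by lia) h₁ h₂
  let e : L ≅ L⟦(-1 : ℤ)⟧⟦(1 : ℤ)⟧ := (shiftEquiv C (1 : ℤ)).counitIso.symm.app L
  refine ⟨L⟦(-1 : ℤ)⟧, R, e.inv ≫ α, β, γ ≫ e.hom⟦1⟧',
    distinguished_of_iso hT' e (Iso.refl _) (Iso.refl _) (by simp) (by simp) (by simp), ?_, ?_⟩
  · exact (t.mem_heart_iff _).2 ⟨t.isLE_shift L (-1) (-1) 0, t.isGE_shift L (-1) (-1) 0⟩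
  · exact (t.mem_heart_iff _).2 ⟨h₆, h₄⟩

variable (t)

lemma heart_admissibleMorphism : AbelianSubcategory.admissibleMorphism t.heart.ι = ⊤ := by
  ext X₁ X₂ f
  refine ⟨fun _ => trivial, fun _ X₃ f₂ f₃ hT => ?_⟩
  obtain ⟨K, Q, α, β, γ, hT', hK, hQ⟩ := heart_exists_kernel_cokernel hT X₁.property X₂.property
  exact ⟨⟨K, hK⟩, ⟨Q, hQ⟩, α, β, γ, hT'⟩

lemma heart_ι_hom_shift_eq_zero ⦃X Y : t.heart.FullSubcategory⦄ ⦃n : ℤ⦄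
    (f : t.heart.ι.obj X ⟶ (t.heart.ι.obj Y)⟦n⟧) (hn : n < 0) : f = 0 :=
  heart_hom_shift_eq_zero X.property Y.property hn f

/-- The heart of a t-structure is an abelian category. -/
@[reducible] noncomputable def heartAbelian [IsTriangulated C] :
    Abelian t.heart.FullSubcategory :=
  AbelianSubcategory.abelian t.heart.ι (heart_ι_hom_shift_eq_zero t) (heart_admissibleMorphism t)

attribute [local instance] heartAbelian

variable {t}

section

variable {X Y Z : t.heart.FullSubcategory} {f : X ⟶ Y} {g : Y ⟶ Z}

lemma heart_comp_eq_zero {δ : Z.obj ⟶ X.obj⟦(1 : ℤ)⟧}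
    (hT : Triangle.mk f.hom g.hom δ ∈ distTriang C) : f ≫ g = 0 :=
  t.heart.hom_ext (comp_eq_zero_of_distinguished hT)

/-- Distinguished triangles with terms in the heart are short exact sequences of the heart. -/
lemma heart_shortExact [IsTriangulated C] {δ : Z.obj ⟶ X.obj⟦(1 : ℤ)⟧}
    (hT : Triangle.mk f.hom g.hom δ ∈ distTriang C) :
    (ShortComplex.mk f g (heart_comp_eq_zero hT)).ShortExact := by
  have h₁ := AbelianSubcategory.isLimitKernelForkOfDistTriang
    (heart_ι_hom_shift_eq_zero t) f g δ hT
  have h₂ := AbelianSubcategory.isColimitCokernelCoforkOfDistTriang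
    (heart_ι_hom_shift_eq_zero t) f g δ hT
  exact .mk' (ShortComplex.exact_of_f_is_kernel _ h₁) (mono_of_isLimit_fork h₁)
    (epi_of_isColimit_cofork h₂)

lemma heart_exists_distinguished [IsTriangulated C] (S : ShortComplex t.heart.FullSubcategory)
    (hS : S.ShortExact) :
    ∃ δ : S.X₃.obj ⟶ S.X₁.obj⟦(1 : ℤ)⟧, Triangle.mk S.f.hom S.g.hom δ ∈ distTriang C := by
  have := hS.epi_g
  have := hS.mono_f
  obtain ⟨K, i, δ, hT⟩ := AbelianSubcategory.exists_distinguished_triangle_of_epi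
    (heart_ι_hom_shift_eq_zero t) (heart_admissibleMorphism t) S.g
  have h₁ := AbelianSubcategory.isLimitKernelForkOfDistTriang
    (heart_ι_hom_shift_eq_zero t) i S.g δ hT
  let e : K ≅ S.X₁ := h₁.conePointUniqueUpToIso hS.exact.fIsKernel
  have he : e.hom ≫ S.f = i :=
    IsLimit.conePointUniqueUpToIso_hom_comp h₁ hS.exact.fIsKernel WalkingParallelPair.zero
  refine ⟨δ ≫ (t.heart.ι.map e.hom)⟦1⟧', distinguished_of_iso hT (t.heart.ι.mapIso e) (Iso.refl _)
    (Iso.refl _) ?_ (by simp) (by simp)⟩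
  simp [← he]

end

end Heart

section Transversality

variable {C : Type u} [Category.{v} C] [HasZeroObject C] [HasShift C ℤ] [Preadditive C]
  [∀ n : ℤ, (shiftFunctor C n).Additive] [Pretriangulated C]
  {t : TStructure C} {w : WeightStructure C}

attribute [local instance] heartAbelian

/-! ### Functoriality and exactness of nice decompositions -/

lemma HasNiceDecompositions.exists_nice (h : HasNiceDecompositions t w) {X : C} (hX : t.heart X)
    (i : ℤ) : ∃ (L R : C) (f : L ⟶ X) (g : X ⟶ R) (δ : R ⟶ L⟦(1 : ℤ)⟧),
      IsNiceDecomposition t w i (Triangle.mk f g δ) := by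
  obtain ⟨T, hT, rfl⟩ := h X hX i
  exact ⟨_, _, T.mor₁, T.mor₂, T.mor₃, hT⟩

lemma IsNiceDecomposition.comp_mor₁_injective {i : ℤ} {T : Triangle C}
    (hT : IsNiceDecomposition t w i T) {W : C} (hW : t.heart W) {a b : W ⟶ T.obj₁}
    (h : a ≫ T.mor₁ = b ≫ T.mor₁) : a = b := by
  obtain ⟨d, ψ, hψ⟩ := exists_lift₁ hT.distinguished (a - b)
    (by rw [Preadditive.sub_comp, h, sub_self])
  rw [heart_hom_shift_eq_zero hW hT.heart₃ (by lia) ψ, zero_comp] at hψ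
  exact sub_eq_zero.1 hψ

lemma IsNiceDecomposition.mor₂_comp_injective {i : ℤ} {T : Triangle C}
    (hT : IsNiceDecomposition t w i T) {W : C} (hW : t.heart W) {a b : T.obj₃ ⟶ W}
    (h : T.mor₂ ≫ a = T.mor₂ ≫ b) : a = b := by
  obtain ⟨ψ, hψ⟩ := exists_desc₃ hT.distinguished (a - b)
    (by rw [Preadditive.comp_sub, h, sub_self])
  rw [heart_shift_hom_eq_zero hT.heart₁ hW (by lia) ψ, comp_zero] at hψ
  exact sub_eq_zero.1 hψ

/-- A morphism extends to decompositions because there are no morphisms from weights `≤ i` to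
weights `≥ i + 1`. The extension is unique because there are no morphisms from the heart to its
negative shifts. -/
lemma niceDecompositionsFunctorial (t : TStructure C) (w : WeightStructure C) :
    NiceDecompositionsFunctorial t w := by
  intro i T T' hT hT' f
  obtain ⟨a, ha⟩ := exists_lift₂ hT'.distinguished (T.mor₁ ≫ f)
    (w.hom_eq_zero (by lia) hT.le hT'.ge _)
  obtain ⟨c, hc₁, hc₂⟩ := complete_distinguished_triangle_morphism T T' hT.distinguished
    hT'.distinguished a f ha
  refine ⟨⟨a, f, c, ha, hc₁, hc₂⟩, rfl, fun φ hφ => ?_⟩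
  ext
  · refine hT'.comp_mor₁_injective hT.heart₁ ?_
    rw [← φ.comm₁, hφ, ha]
  · exact hφ
  · refine hT.mor₂_comp_injective hT'.heart₃ ?_
    rw [φ.comm₂, hφ, hc₁]

/-- In the heart, the objects of weight `≤ i` and those of weight `≥ i + 1` form a torsion pair,
and the weight orthogonality kills the extensions in the other direction. -/
lemma HasNiceDecompositions.isSplitTorsionPair [IsTriangulated C] (h : HasNiceDecompositions t w)
    (i : ℤ) : IsSplitTorsionPair ((w.le i).inverseImage t.heart.ι)
      ((w.ge (i + 1)).inverseImage t.heart.ι) where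
  isClosedUnderIsomorphisms_left := inferInstance
  isClosedUnderIsomorphisms_right := inferInstance
  hom_eq_zero X Y hX hY f := t.heart.hom_ext (w.hom_eq_zero (by lia) hX hY _)
  exists_shortExact X := by
    obtain ⟨L, R, f, g, δ, hT⟩ := h.exists_nice X.property i
    exact ⟨⟨L, hT.heart₁⟩, ⟨R, hT.heart₃⟩, homMk f, homMk g, _,
      heart_shortExact (X := ⟨L, hT.heart₁⟩) (Y := X) (Z := ⟨R, hT.heart₃⟩) (f := homMk f)
        (g := homMk g) hT.distinguished, hT.le, hT.ge⟩
  splits S hS h₁ h₃ := by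
    obtain ⟨δ, hT⟩ := heart_exists_distinguished S hS
    have hδ : δ = 0 := w.hom_eq_zero (by lia : i < i + 2) h₃ (w.ge_shift (by lia) h₁) δ
    obtain ⟨s, hs⟩ := exists_lift₃ hT (𝟙 _) (by rw [hδ, comp_zero])
    exact ⟨ShortComplex.Splitting.ofExactOfSection S hS.exact (homMk s)
      (t.heart.hom_ext hs.symm) hS.mono_f⟩

lemma niceDecompositionFunctorsExact [IsTriangulated C] (h : HasNiceDecompositions t w) :
    NiceDecompositionFunctorsExact t w := by
  intro i
  choose l r f g δ hT using fun X : t.heart.FullSubcategory => h.exists_nice X.property i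
  -- the functor `X ↦ (w_{≤ i} X ⟶ X ⟶ w_{≥ i + 1} X)`, by unique extension of morphisms
  have key (X Y : t.heart.FullSubcategory) (φ : X ⟶ Y) :=
    niceDecompositionsFunctorial t w i _ _ (hT X) (hT Y) φ.hom
  choose F hF hF' using key
  have ext {X Y : t.heart.FullSubcategory}
      {a b : Triangle.mk (f X) (g X) (δ X) ⟶ Triangle.mk (f Y) (g Y) (δ Y)}
      (hab : a.hom₂ = b.hom₂) : a = b :=
    (niceDecompositionsFunctorial t w i _ _ (hT X) (hT Y) a.hom₂).unique rfl hab.symm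
  have F_id (X : t.heart.FullSubcategory) : F X X (𝟙 X) = 𝟙 _ := ext (hF _ _ _)
  have F_comp {X Y Z : t.heart.FullSubcategory} (φ : X ⟶ Y) (ψ : Y ⟶ Z) :
      F X Z (φ ≫ ψ) = F X Y φ ≫ F Y Z ψ := ext (by
    refine (hF _ _ _).trans ?_
    rw [comp_hom₂]
    erw [hF, hF]
    rfl)
  let L : t.heart.FullSubcategory ⥤ t.heart.FullSubcategory :=
    { obj X := ⟨l X, (hT X).heart₁⟩
      map {X Y} φ := homMk (F X Y φ).hom₁
      map_id X := t.heart.hom_ext (congr_arg TriangleMorphism.hom₁ (F_id X))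
      map_comp φ ψ := t.heart.hom_ext (congr_arg TriangleMorphism.hom₁ (F_comp φ ψ)) }
  let R : t.heart.FullSubcategory ⥤ t.heart.FullSubcategory :=
    { obj X := ⟨r X, (hT X).heart₃⟩
      map {X Y} φ := homMk (F X Y φ).hom₃
      map_id X := t.heart.hom_ext (congr_arg TriangleMorphism.hom₃ (F_id X))
      map_comp φ ψ := t.heart.hom_ext (congr_arg TriangleMorphism.hom₃ (F_comp φ ψ)) }
  let ι (X : t.heart.FullSubcategory) : L.obj X ⟶ X := homMk (f X)
  let π (X : t.heart.FullSubcategory) : X ⟶ R.obj X := homMk (g X)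
  have hι ⦃X Y : t.heart.FullSubcategory⦄ (φ : X ⟶ Y) : L.map φ ≫ ι Y = ι X ≫ φ :=
    t.heart.hom_ext (((F X Y φ).comm₁.symm).trans (congr_arg (f X ≫ ·) (hF X Y φ)))
  have hπ ⦃X Y : t.heart.FullSubcategory⦄ (φ : X ⟶ Y) : φ ≫ π Y = π X ≫ R.map φ :=
    t.heart.hom_ext ((congr_arg (· ≫ g Y) (hF X Y φ).symm).trans (F X Y φ).comm₂.symm)
  have hS (X : t.heart.FullSubcategory) := heart_shortExact (f := ι X) (g := π X)
    (hT X).distinguished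
  have htp := h.isSplitTorsionPair i
  refine ⟨L, R, { app := ι, naturality := hι }, { app := π, naturality := hπ },
    { app := δ, naturality := fun X Y φ => (F X Y φ).comm₃.symm }, hT, ?_, ?_⟩
  · exact htp.exact_left L R ι π hι hπ _ hS (fun X => (hT X).le) (fun X => (hT X).ge)
  · exact htp.exact_right L R ι π hι hπ _ hS (fun X => (hT X).le) (fun X => (hT X).ge)

/-! ### Nice decompositions and images -/

section

variable [IsTriangulated C]

lemma π_cohZeroMap {Y : C} {X : t.heart.FullSubcategory} (f : Y ⟶ X.obj) :
    (t.truncGEπ 0).app ((t.truncLE 0).obj Y) ≫ (cohZeroMap t f).hom =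
      (t.truncLEι 0).app Y ≫ f := by
  have : t.IsGE X.obj 0 := ((t.mem_heart_iff _).1 X.property).2
  exact t.π_descTruncGE _ 0

lemma π_comp_cohZero_injective {Y : C} {X : t.heart.FullSubcategory} {a b : cohZero t Y ⟶ X}
    (h : (t.truncGEπ 0).app ((t.truncLE 0).obj Y) ≫ a.hom =
      (t.truncGEπ 0).app ((t.truncLE 0).obj Y) ≫ b.hom) : a = b := by
  have : t.IsGE X.obj 0 := ((t.mem_heart_iff _).1 X.property).2
  exact t.heart.hom_ext (t.from_truncGE_obj_ext h)

/-- Given a nice decomposition `L₀ ⟶ X ⟶ R₀` and any weight decomposition `L ⟶ X ⟶ R`, the morphisms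
`L ⟶ X` and `L₀ ⟶ X` factor through each other. As `L₀ ⟶ X` is a monomorphism, `L₀` is therefore a
direct summand of `H⁰(L)` and the image of `H⁰(L) ⟶ X`. -/
lemma allImagesExtend (h : HasNiceDecompositions t w) : AllImagesExtend t w := by
  intro X i L R f g δ hT
  obtain ⟨L₀, R₀, f₀, g₀, δ₀, hT₀⟩ := h.exists_nice X.property i
  obtain ⟨a, ha⟩ := exists_lift₂ hT₀.distinguished f (w.hom_eq_zero (by lia) hT.le hT₀.ge _)
  obtain ⟨b, hb⟩ := exists_lift₂ hT.distinguished f₀ (w.hom_eq_zero (by lia) hT₀.le hT.ge _)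
  let I : t.heart.FullSubcategory := ⟨L₀, hT₀.heart₁⟩
  have : t.IsLE L₀ 0 := ((t.mem_heart_iff _).1 hT₀.heart₁).1
  let m : I ⟶ X := homMk f₀
  have hm : Mono m := ⟨fun u v huv => t.heart.hom_ext
    (hT₀.comp_mor₁_injective (FullSubcategory.property _)
      (congr_arg InducedCategory.Hom.hom huv))⟩
  let e : cohZero t L ⟶ I := cohZeroMap t (X := I) a
  have he : e ≫ m = cohZeroMap t f := by
    refine π_comp_cohZero_injective (Eq.trans ?_ (π_cohZeroMap f).symm)
    exact (Category.assoc _ _ _).symm.trans ((congr_arg (· ≫ f₀) (π_cohZeroMap (X := I) a)).trans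
      ((Category.assoc _ _ _).trans (congr_arg ((t.truncLEι 0).app L ≫ ·) ha.symm)))
  let s : I ⟶ cohZero t L :=
    homMk (t.liftTruncLE b 0 ≫ (t.truncGEπ 0).app ((t.truncLE 0).obj L))
  have hs : s ≫ cohZeroMap t f = m :=
    t.heart.hom_ext ((Category.assoc _ _ _).trans
      ((congr_arg (t.liftTruncLE b 0 ≫ ·) (π_cohZeroMap f)).trans
        ((t.liftTruncLE_ι_assoc b 0 f).trans hb.symm)))
  refine ⟨⟨⟨I, m, e, he⟩, ⟨fun F' => s ≫ F'.e, fun F' => ?_⟩⟩, R₀, g₀, δ₀, hT₀⟩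
  rw [Category.assoc, F'.fac, hs]

lemma someImagesExtend_of_allImagesExtend (h : AllImagesExtend t w) : SomeImagesExtend t w := by
  intro X i
  obtain ⟨L, R, f, g, δ, hT⟩ := w.exists_weightDecomposition X.obj i
  exact ⟨L, R, f, g, δ, hT, h X i L R f g δ hT⟩

lemma hasNiceDecompositions_of_someImagesExtend (h : SomeImagesExtend t w) :
    HasNiceDecompositions t w := by
  intro X hX i
  obtain ⟨L, R, f, g, δ, hT, I, R', g', δ', hT'⟩ := h ⟨X, hX⟩ i
  exact ⟨_, hT', rfl⟩

/-- The equivalent forms of transversality of `t` and `w`. -/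
lemma transversal_tfae (t : TStructure C) (w : WeightStructure C) :
    List.TFAE [HasNiceDecompositions t w, HasExactNiceDecompositions t w,
      SomeImagesExtend t w, AllImagesExtend t w] := by
  tfae_have 1 → 2 := fun h =>
    ⟨h, niceDecompositionsFunctorial t w, niceDecompositionFunctorsExact h⟩
  tfae_have 2 → 1 := fun h => h.1
  tfae_have 1 → 4 := allImagesExtend
  tfae_have 4 → 3 := someImagesExtend_of_allImagesExtend
  tfae_have 3 → 1 := hasNiceDecompositions_of_someImagesExtend
  tfae_finish

end

end Transversality

section PureObjects

variable {C : Type u} [Category.{v} C] [HasZeroObject C] [HasShift C ℤ] [Preadditive C]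
  [∀ n : ℤ, (shiftFunctor C n).Additive] [Pretriangulated C]

/-! ### Pure objects of the heart -/

/-- A full additive subcategory of `C` without morphisms to its negative shifts and to its shift
by `1`, in which all morphisms are admissible, is abelian and semi-simple. -/
lemma isSemisimpleAbelian_of_hom_shift_eq_zero [IsTriangulated C] (P : ObjectProperty C)
    [P.IsClosedUnderFiniteProducts]
    (hP : ∀ (X Y : C) (n : ℤ), n < 0 ∨ n = 1 → P X → P Y → ∀ f : X ⟶ Y⟦n⟧, f = 0)
    (hP' : AbelianSubcategory.admissibleMorphism P.ι = ⊤) :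
    IsSemisimpleAbelian P.FullSubcategory := by
  have hι ⦃X Y : P.FullSubcategory⦄ ⦃n : ℤ⦄ (f : P.ι.obj X ⟶ (P.ι.obj Y)⟦n⟧) (hn : n < 0) :
      f = 0 := hP _ _ n (Or.inl hn) X.property Y.property f
  let : Abelian P.FullSubcategory := AbelianSubcategory.abelian P.ι hι hP'
  exact
    { hasFiniteProducts := inferInstance
      hasKernels := inferInstance
      hasCokernels := inferInstance
      isNormalMonoCategory := inferInstance
      isNormalEpiCategory := inferInstance
      splits S hS := by
        have := hS.epi_g
        obtain ⟨K, i, δ, hT⟩ :=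
          AbelianSubcategory.exists_distinguished_triangle_of_epi hι hP' S.g
        obtain ⟨s, hs⟩ := exists_lift₃ hT (𝟙 _)
          (by rw [hP _ _ 1 (Or.inr rfl) S.X₃.property K.property δ, comp_zero])
        exact ⟨ShortComplex.Splitting.ofExactOfSection S hS.exact (homMk s)
          (P.hom_ext hs.symm) hS.mono_f⟩ }

variable (t : TStructure C) (w : WeightStructure C)

/-- The objects of the heart of `t` which are pure of weight `i`. -/
def pureHeart (i : ℤ) : ObjectProperty C := t.heart ⊓ (w.le i ⊓ w.ge i)

instance (i : ℤ) : (pureHeart t w i).IsClosedUnderIsomorphisms :=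
  inferInstanceAs (t.heart ⊓ (w.le i ⊓ w.ge i)).IsClosedUnderIsomorphisms

instance (i : ℤ) : (pureHeart t w i).IsClosedUnderFiniteProducts := by
  obtain ⟨Z, hZ, hZ'⟩ := t.heart.exists_prop_of_containsZero
  have : (pureHeart t w i).ContainsZero :=
    ⟨Z, hZ, hZ', w.le_of_isZero hZ i, w.ge_of_isZero hZ i⟩
  have : (pureHeart t w i).IsTriangulatedClosed₂ := .mk' fun T hT h₁ h₃ =>
    ⟨t.heart.ext_of_isTriangulatedClosed₂ T hT h₁.1 h₃.1,
      (w.le i).ext_of_isTriangulatedClosed₂ T hT h₁.2.1 h₃.2.1,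
      (w.ge i).ext_of_isTriangulatedClosed₂ T hT h₁.2.2 h₃.2.2⟩
  exact isClosedUnderFiniteProducts_of_isTriangulatedClosed₂ _

lemma pureHeart_isAdditiveFamily : IsAdditiveFamily (pureHeart t w) where
  isClosedUnderIsomorphisms _ := inferInstance
  isClosedUnderFiniteProducts _ := inferInstance

lemma pureHeart_isSemiOrthogonal : IsSemiOrthogonal (pureHeart t w) := by
  rintro i j s (hs | hs) X Y hX hY f
  · exact heart_hom_shift_eq_zero hX.1 hY.1 hs f
  · exact w.hom_eq_zero (by lia : i < j + s) hX.2.1 (w.ge_shift rfl hY.2.2) f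

variable {t w} [IsTriangulated C] (h : HasNiceDecompositions t w)

attribute [local instance] heartAbelian

include h

namespace HasNiceDecompositions

variable {i : ℤ} {X Y : t.heart.FullSubcategory} (f : X ⟶ Y)

lemma le_of_mono [Mono f] (hY : w.le i Y.obj) : w.le i X.obj :=
  (h.isSplitTorsionPair i).left_of_mono f hY

lemma le_of_epi [Epi f] (hX : w.le i X.obj) : w.le i Y.obj :=
  (h.isSplitTorsionPair i).left_of_epi f hX

lemma ge_of_mono [Mono f] (hY : w.ge i Y.obj) : w.ge i X.obj := by
  obtain ⟨i, rfl⟩ : ∃ k, i = k + 1 := ⟨i - 1, by lia⟩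
  exact (h.isSplitTorsionPair i).right_of_mono f hY

lemma ge_of_epi [Epi f] (hX : w.ge i X.obj) : w.ge i Y.obj := by
  obtain ⟨i, rfl⟩ : ∃ k, i = k + 1 := ⟨i - 1, by lia⟩
  exact (h.isSplitTorsionPair i).right_of_epi f hX

lemma pureHeart_isStronglySemiOrthogonal : IsStronglySemiOrthogonal (pureHeart t w) := by
  refine ⟨pureHeart_isSemiOrthogonal t w, fun i j hij X Y hX hY f => ?_⟩
  exact congr_arg InducedCategory.Hom.hom ((h.isSplitTorsionPair j).hom_eq_zero'
    (X := ⟨X, hX.1⟩) (Y := ⟨Y, hY.1⟩) (w.ge_antitone (by lia) _ hX.2.2) hY.2.1 (homMk f))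

/-- Kernels and cokernels of morphisms of pure objects are pure of the same weight, as weights in the
heart pass to subobjects and quotients. -/
lemma pureHeart_isSemisimpleAbelian (i : ℤ) :
    IsSemisimpleAbelian (pureHeart t w i).FullSubcategory := by
  refine isSemisimpleAbelian_of_hom_shift_eq_zero _ (fun X Y n hn hX hY f =>
    pureHeart_isSemiOrthogonal t w i i n (by lia) X Y hX hY f) ?_
  ext X₁ X₂ f
  refine ⟨fun _ => trivial, fun _ X₃ f₂ f₃ hT => ?_⟩
  obtain ⟨K, Q, α, β, γ, hT', hK, hQ⟩ :=
    heart_exists_kernel_cokernel hT X₁.property.1 X₂.property.1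
  let Y₁ : t.heart.FullSubcategory := ⟨X₁.obj, X₁.property.1⟩
  let Y₂ : t.heart.FullSubcategory := ⟨X₂.obj, X₂.property.1⟩
  let φ : Y₁ ⟶ Y₂ := homMk f.hom
  let K' : t.heart.FullSubcategory := ⟨K, hK⟩
  let Q' : t.heart.FullSubcategory := ⟨Q, hQ⟩
  let k : K' ⟶ Y₁ := AbelianSubcategory.ιK (ι := t.heart.ι) (X₁ := Y₁) (K := K') f₃ α
  let q : Y₂ ⟶ Q' := AbelianSubcategory.πQ (ι := t.heart.ι) (X₂ := Y₂) (Q := Q') f₂ β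
  have : Mono k := AbelianSubcategory.mono_ιK (ι := t.heart.ι) (f₁ := φ) (K := K') (Q := Q')
    (heart_ι_hom_shift_eq_zero t) hT hT'
  have : Epi q := AbelianSubcategory.epi_πQ (ι := t.heart.ι) (f₁ := φ) (K := K') (Q := Q')
    (heart_ι_hom_shift_eq_zero t) hT hT'
  exact ⟨⟨K, hK, h.le_of_mono k X₁.property.2.1, h.ge_of_mono k X₁.property.2.2⟩,
    ⟨Q, hQ, h.le_of_epi q X₂.property.2.1, h.ge_of_epi q X₂.property.2.2⟩, α, β, γ, hT'⟩

/-- A nice decomposition does not enlarge the interval of weights. -/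
lemma exists_nice_pure {X : C} (hX : t.heart X) (i : ℤ) :
    ∃ (L R : C) (f : L ⟶ X) (g : X ⟶ R) (δ : R ⟶ L⟦(1 : ℤ)⟧),
      IsNiceDecomposition t w i (Triangle.mk f g δ) ∧ (∀ a, w.ge a X → w.ge a L) ∧
        ∀ b, w.le b X → w.le b R := by
  obtain ⟨L, R, f, g, δ, hT⟩ := h.exists_nice hX i
  have hS := heart_shortExact (X := ⟨L, hT.heart₁⟩) (Y := ⟨X, hX⟩) (Z := ⟨R, hT.heart₃⟩)
    (f := homMk f) (g := homMk g) hT.distinguished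
  have := hS.mono_f
  have := hS.epi_g
  exact ⟨L, R, f, g, δ, hT,
    fun a ha => h.ge_of_mono (X := ⟨L, hT.heart₁⟩) (Y := ⟨X, hX⟩) (homMk f) ha,
    fun b hb => h.le_of_epi (X := ⟨X, hX⟩) (Y := ⟨R, hT.heart₃⟩) (homMk g) hb⟩

lemma heart_le_envelope (hw : w.IsBounded) :
    t.heart ≤ Envelope (fun X => ∃ i, pureHeart t w i X) := by
  have key : ∀ (n : ℕ) (a : ℤ) (X : C), t.heart X → w.ge a X → w.le (a + n) X →
      Envelope (fun X => ∃ i, pureHeart t w i X) X := by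
    intro n
    induction n with
    | zero => exact fun a X hX ha hb => .of _ ⟨a, hX, by simpa using hb, ha⟩
    | succ n ih =>
      intro a X hX ha hb
      obtain ⟨L, R, f, g, δ, hT, hL, hR⟩ := h.exists_nice_pure hX (a + n)
      refine .ext (Triangle.mk f g δ) hT.distinguished (ih a L hT.heart₁ (hL a ha) hT.le)
        (.of _ ⟨a + n + 1, hT.heart₃, hR _ ?_, hT.ge⟩)
      have : a + ((n + 1 : ℕ) : ℤ) = a + n + 1 := by push_cast; ring
      rwa [← this]
  intro X hX
  obtain ⟨a, b, ha, hb⟩ := hw X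
  exact key (b - a).toNat a X hX ha (w.le_monotone (by lia) _ hb)

lemma pureHeart_isGenerating (ht : IsBoundedTStructure t) (hw : w.IsBounded) :
    IsGenerating (pureHeart t w) := by
  intro P hP hP' hA
  refine ht.induction P fun X n hX => P.le_shift n _ ?_
  exact Envelope.le_of_le (fun Y ⟨i, hY⟩ => hA i Y hY) _ (h.heart_le_envelope hw _ hX)

end HasNiceDecompositions

end PureObjects

section WeightFiltrations

variable {C : Type u} [Category.{v} C] [HasZeroObject C] [HasShift C ℤ] [Preadditive C]
  [∀ n : ℤ, (shiftFunctor C n).Additive] [Pretriangulated C] [IsTriangulated C]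
  {t : TStructure C} {w : WeightStructure C} {A : ℤ → ObjectProperty C}

attribute [local instance] heartAbelian

/-! ### Weight filtrations of objects of the heart -/

namespace HeartFiltration

variable {X : t.heart.FullSubcategory} (F : HeartFiltration t A X)

lemma exists_shortExact (i : ℤ) : ∃ (G : t.heart.FullSubcategory)
    (p : (F.W i : t.heart.FullSubcategory) ⟶ G)
    (hp : Subobject.ofLE (F.W (i - 1)) (F.W i) (F.mono (by lia)) ≫ p = 0),
    (ShortComplex.mk _ p hp).ShortExact ∧ A i G.obj := by
  obtain ⟨G, p, hp, ⟨h⟩, hG⟩ := F.graded i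
  exact ⟨G, p, hp, .mk' (ShortComplex.exact_of_g_is_cokernel _ h)
    (inferInstanceAs (Mono (Subobject.ofLE _ _ _))) (epi_of_isColimit_cofork h), hG⟩

/-- Steps of a filtration are iterated extensions of its graded pieces. -/
lemma prop_W (P : ObjectProperty C) [P.IsTriangulatedClosed₂] [P.IsClosedUnderIsomorphisms]
    [P.ContainsZero] {m : ℤ} (hP : ∀ i ≤ m, A i ≤ P) :
    P (F.W m : t.heart.FullSubcategory).obj := by
  obtain ⟨a, ha⟩ := F.separated
  have zero (i : ℤ) (hi : i ≤ a) : P (F.W i : t.heart.FullSubcategory).obj :=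
    P.prop_of_isZero (t.heart.ι.map_isZero (ha.of_mono (Subobject.ofLE _ _ (F.mono hi))))
  have key (n : ℕ) : a + n ≤ m → P (F.W (a + n) : t.heart.FullSubcategory).obj := by
    induction n with
    | zero => exact fun _ => zero _ (by simp)
    | succ n ih =>
      intro hn
      push_cast at hn
      obtain ⟨G, p, hp, hS, hG⟩ := F.exists_shortExact (a + (n + 1 : ℕ))
      obtain ⟨δ, hT⟩ := heart_exists_distinguished _ hS
      have e : a + ((n + 1 : ℕ) : ℤ) - 1 = a + n := by push_cast; ring
      have h₁ : P (F.W (a + (n + 1 : ℕ) - 1) : t.heart.FullSubcategory).obj := by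
        rw [e]
        exact ih (by lia)
      exact P.ext_of_isTriangulatedClosed₂ _ hT h₁ (hP _ (by push_cast; lia) _ hG)
  obtain hm | hm := le_total m a
  · exact zero m hm
  · obtain ⟨n, rfl⟩ := Int.le.dest hm
    exact key n le_rfl

include F in
lemma prop (P : ObjectProperty C) [P.IsTriangulatedClosed₂] [P.IsClosedUnderIsomorphisms]
    [P.ContainsZero] (hP : ∀ i, A i ≤ P) : P X.obj := by
  obtain ⟨b, hb⟩ := F.exhaustive
  have := (Subobject.isIso_arrow_iff_eq_top _).2 hb
  exact P.prop_of_iso (t.heart.ι.mapIso (asIso (F.W b).arrow)) (F.prop_W P fun i _ => hP i)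

/-- A morphism from an object of weight `≤ i` factors through `W_{≤ i}`, as there are no morphisms
from weight `≤ i` to the graded pieces of weight `> i`. -/
lemma factors (hA : ∀ i, A i ≤ w.ge i) {i : ℤ} {Z : t.heart.FullSubcategory}
    (hZ : w.le i Z.obj) (f : Z ⟶ X) : (F.W i).Factors f := by
  have key (n : ℕ) : (F.W (i + n)).Factors f → (F.W i).Factors f := by
    induction n with
    | zero => simp
    | succ n ih =>
      refine fun h => ih ?_
      obtain ⟨G, p, hp, hS, hG⟩ := F.exists_shortExact (i + (n + 1 : ℕ))
      have := hS.mono_f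
      have hψ : (F.W (i + (n + 1 : ℕ))).factorThru f h ≫ p = 0 :=
        t.heart.hom_ext (w.hom_eq_zero (by push_cast; lia) hZ (hA _ _ hG) _)
      obtain ⟨l, hl⟩ := hS.exact.lift' _ hψ
      have hl : l ≫ Subobject.ofLE _ _ _ = (F.W (i + (n + 1 : ℕ))).factorThru f h := hl
      have e : i + ((n + 1 : ℕ) : ℤ) - 1 = i + n := by push_cast; ring
      rw [← e, ← Subobject.factorThru_arrow _ f h, ← hl, Category.assoc, Subobject.ofLE_arrow]
      exact Subobject.factors_comp_arrow _
  obtain ⟨b, hb⟩ := F.exhaustive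
  refine key (b - i).toNat (Subobject.factors_of_le f (F.mono (by lia : b ≤ _)) ?_)
  rw [hb]
  exact Subobject.top_factors f

end HeartFiltration

lemma heartFiltrationsFunctorial (h₁ : ∀ i, A i ≤ w.le i) (h₂ : ∀ i, A i ≤ w.ge i) :
    HeartFiltrationsFunctorial t A := fun _ _ F F' _ i =>
  F'.factors h₂ (F.prop_W (w.le i) fun j hj => (h₁ j).trans (w.le_monotone hj)) _

/-- The weight filtration is given by `W_{≤ i} X = w_{≤ i} X`, for nice decompositions of `X`. -/
lemma HasNiceDecompositions.hasHeartFiltrations (h : HasNiceDecompositions t w)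
    (hw : w.IsBounded) : HasHeartFiltrations t (pureHeart t w) := by
  intro X
  choose L R f g δ hT using h.exists_nice X.property
  let L' (i : ℤ) : t.heart.FullSubcategory := ⟨L i, (hT i).heart₁⟩
  let R' (i : ℤ) : t.heart.FullSubcategory := ⟨R i, (hT i).heart₃⟩
  let ι (i : ℤ) : L' i ⟶ X := homMk (f i)
  let π (i : ℤ) : X ⟶ R' i := homMk (g i)
  have hS (i : ℤ) := heart_shortExact (f := ι i) (g := π i) (hT i).distinguished
  have (i : ℤ) : Mono (ι i) := (hS i).mono_f
  let W (i : ℤ) : Subobject X := Subobject.mk (ι i)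
  have hι (i : ℤ) : ι i ≫ π i = 0 := heart_comp_eq_zero (hT i).distinguished
  have factors (i : ℤ) {Z : t.heart.FullSubcategory} (φ : Z ⟶ X) (hφ : φ ≫ π i = 0) :
      (W i).Factors φ := by
    obtain ⟨l, hl⟩ := (hS i).exact.lift' φ hφ
    exact (Subobject.mk_factors_iff _ _).2 ⟨l, hl⟩
  have arrow_π (i : ℤ) : (W i).arrow ≫ π i = 0 := by
    rw [← cancel_epi (Subobject.underlyingIso (ι i)).inv, Subobject.underlyingIso_arrow_assoc,
      comp_zero]
    exact hι i
  have W_le (i : ℤ) : w.le i (W i : t.heart.FullSubcategory).obj :=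
    (w.le i).prop_of_iso (t.heart.ι.mapIso (Subobject.underlyingIso (ι i)).symm) (hT i).le
  have mono : Monotone W := fun i j hij =>
    Subobject.le_of_comm _ (Subobject.factorThru_arrow _ _ (factors j (W i).arrow
      (t.heart.hom_ext (w.hom_eq_zero (by lia) (W_le i) (hT j).ge _))))
  obtain ⟨a, b, ha, hb⟩ := hw X.obj
  refine ⟨⟨W, mono, ⟨a - 1, ?_⟩, ⟨b, ?_⟩, fun i => ?_⟩⟩
  · exact IsZero.of_mono_eq_zero (W (a - 1)).arrow
      (t.heart.hom_ext (w.hom_eq_zero (by lia) (W_le (a - 1)) ha _))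
  · refine top_le_iff.1 (Subobject.le_of_comm _ (Subobject.factorThru_arrow _ _
      (factors b _ (t.heart.hom_ext ?_))))
    have : π b = 0 := t.heart.hom_ext (w.hom_eq_zero (by lia) hb (hT b).ge _)
    rw [this, comp_zero]
  · let j := Subobject.ofLE (W (i - 1)) (W i) (mono (by lia))
    have zero : j ≫ (W i).arrow ≫ π (i - 1) = 0 := by
      rw [Subobject.ofLE_arrow_assoc, arrow_π]
    have exact : (ShortComplex.mk _ _ zero).Exact :=
      ShortComplex.exact_of_f_is_kernel _ (KernelFork.IsLimit.ofι' _ _ fun {Z} k hk =>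
        ⟨(W (i - 1)).factorThru (k ≫ (W i).arrow) (factors _ _ (by simpa using hk)), by
          rw [← cancel_mono (W i).arrow, Category.assoc, Subobject.ofLE_arrow,
            Subobject.factorThru_arrow]⟩)
    have := (ShortComplex.exact_iff_mono_cokernel_desc _).1 exact
    refine ⟨cokernel j, cokernel.π j, cokernel.condition j, ⟨cokernelIsCokernel j⟩,
      FullSubcategory.property _, h.le_of_epi (cokernel.π j) (W_le i), ?_⟩
    obtain ⟨k, rfl⟩ : ∃ k, i = k + 1 := ⟨i - 1, by lia⟩
    refine h.ge_of_mono (cokernel.desc j ((W (k + 1)).arrow ≫ π (k + 1 - 1)) zero) ?_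
    have := (hT (k + 1 - 1)).ge
    rwa [show k + 1 - 1 + 1 = k + 1 by lia] at this

/-- Existence of filtrations means that the graded pieces generate the heart by extensions. -/
lemma HasHeartFiltrations.envelopeGivesHeart (hA : IsAdditiveFamily A) (hA' : ∀ i, A i ≤ t.heart)
    (h : HasHeartFiltrations t A) : EnvelopeGivesHeart t A := by
  have := hA.containsZero 0
  have : ObjectProperty.ContainsZero fun X => ∃ i, A i X := by
    obtain ⟨Z, hZ, h⟩ := (A 0).exists_prop_of_containsZero
    exact ⟨Z, hZ, 0, h⟩
  have : ObjectProperty.IsClosedUnderIsomorphisms fun X => ∃ i, A i X :=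
    ⟨fun e ⟨i, hi⟩ => ⟨i, have := hA.isClosedUnderIsomorphisms i; (A i).prop_of_iso e hi⟩⟩
  refine le_antisymm (fun X hX => ?_) (Envelope.le_of_le fun X ⟨i, hX⟩ => hA' i X hX)
  obtain ⟨F⟩ := h ⟨X, hX⟩
  exact F.prop _ fun i Y hY => .of _ ⟨i, hY⟩

end WeightFiltrations

section FamiliesToWeights

variable {C : Type u} [Category.{v} C] [HasZeroObject C] [HasShift C ℤ] [Preadditive C]
  [∀ n : ℤ, (shiftFunctor C n).Additive] [Pretriangulated C]
  {t : TStructure C} {A : ℤ → ObjectProperty C}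

/-! ### From envelopes to nice decompositions -/

lemma isLE_of_retract {X Y : C} (r : Retract X Y) (n : ℤ) (hY : t.IsLE Y n) : t.IsLE X n := by
  rw [t.isLE_iff_orthogonal n (n + 1) rfl] at hY ⊢
  intro Z f hZ
  rw [← r.retract_assoc f, hY Z (r.r ≫ f) hZ, comp_zero]

lemma isGE_of_retract {X Y : C} (r : Retract X Y) (n : ℤ) (hY : t.IsGE Y n) : t.IsGE X n := by
  rw [t.isGE_iff_orthogonal (n - 1) n (by lia)] at hY ⊢
  intro Z f hZ
  rw [← Category.comp_id f, ← r.retract, ← Category.assoc, hY Z (f ≫ r.i) hZ, zero_comp]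

/-- If `f : I ⟶ X` is a retract of `f' : L ⟶ X` over `X`, then the cone of `f` is a retract of the
cone of `f'`. -/
lemma exists_retract_cone {I L X J R : C} {f : I ⟶ X} {g : X ⟶ J} {h : J ⟶ I⟦(1 : ℤ)⟧}
    {f' : L ⟶ X} {g' : X ⟶ R} {h' : R ⟶ L⟦(1 : ℤ)⟧} (hT : Triangle.mk f g h ∈ distTriang C)
    (hT' : Triangle.mk f' g' h' ∈ distTriang C) (r : Retract I L) (h₁ : r.i ≫ f' = f)
    (h₂ : r.r ≫ f = f') : Nonempty (Retract J R) := by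
  obtain ⟨c, hc, hc'⟩ : ∃ c : J ⟶ R, g ≫ c = 𝟙 X ≫ g' ∧ h ≫ r.i⟦(1 : ℤ)⟧' = c ≫ h' :=
    complete_distinguished_triangle_morphism _ _ hT hT' r.i (𝟙 X)
      ((Category.comp_id _).trans h₁.symm)
  obtain ⟨d, hd, hd'⟩ : ∃ d : R ⟶ J, g' ≫ d = 𝟙 X ≫ g ∧ h' ≫ r.r⟦(1 : ℤ)⟧' = d ≫ h :=
    complete_distinguished_triangle_morphism _ _ hT' hT r.r (𝟙 X)
      ((Category.comp_id _).trans h₂.symm)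
  let φ : Triangle.mk f g h ⟶ Triangle.mk f' g' h' :=
    ⟨r.i, 𝟙 X, c, (Category.comp_id _).trans h₁.symm, hc, hc'⟩
  let ψ : Triangle.mk f' g' h' ⟶ Triangle.mk f g h :=
    ⟨r.r, 𝟙 X, d, (Category.comp_id _).trans h₂.symm, hd, hd'⟩
  have : IsIso (c ≫ d) := isIso₃_of_isIso₁₂ (φ ≫ ψ) hT hT
    (by
      change IsIso (r.i ≫ r.r)
      rw [r.retract]
      infer_instance)
    (by
      change IsIso (𝟙 X ≫ 𝟙 X)
      infer_instance)
  have e : c ≫ d ≫ inv (c ≫ d) = 𝟙 J := by rw [← Category.assoc, IsIso.hom_inv_id]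
  exact ⟨⟨c, d ≫ inv (c ≫ d), e⟩⟩

/-- If an object `X` of the heart has a weight decomposition with terms in `C^{t ≤ 0}` and another
one with terms in `C^{t ≥ 0}`, then it has a nice decomposition. Indeed, for the first terms `L` and
`L'` of these, the truncation `I = τ_{≤ 0} L'` is a direct summand both of `L` and of `L'`, over
`X`, and so the cone of `I ⟶ X` is a direct summand of both third terms. -/
lemma exists_isNiceDecomposition_of_le_of_ge {w : WeightStructure C} {i : ℤ} {X L R L' R' : C}
    (hX : t.heart X) {f : L ⟶ X} {g : X ⟶ R} {δ : R ⟶ L⟦(1 : ℤ)⟧} {f' : L' ⟶ X} {g' : X ⟶ R'}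
    {δ' : R' ⟶ L'⟦(1 : ℤ)⟧} (hT : IsWeightDecomposition w i (Triangle.mk f g δ))
    (hT' : IsWeightDecomposition w i (Triangle.mk f' g' δ')) (hL : t.IsLE L 0) (hR : t.IsLE R 0)
    (hL' : t.IsGE L' 0) (hR' : t.IsGE R' 0) :
    ∃ T : Triangle C, IsNiceDecomposition t w i T ∧ T.obj₂ = X := by
  obtain ⟨a, ha⟩ := exists_lift₂ hT'.distinguished f (w.hom_eq_zero (by lia) hT.le hT'.ge _)
  obtain ⟨b, hb⟩ := exists_lift₂ hT.distinguished f' (w.hom_eq_zero (by lia) hT'.le hT.ge _)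
  obtain ⟨I, S, hI, hS, ι, π, γ, hT₀⟩ := t.exists_triangle L' 0 1 rfl
  have hI : t.IsLE I 0 := ⟨hI⟩
  have hS : t.IsGE S 1 := ⟨hS⟩
  obtain ⟨a', ha'⟩ := exists_lift₂ hT₀ a (t.zero _ 0 1)
  -- the composition with `I ⟶ X` is injective on endomorphisms of `I`
  have inj₁ (u : I ⟶ I) (hu : u ≫ ι = 0) : u = 0 := by
    obtain ⟨d, ψ, rfl⟩ := exists_lift₁ hT₀ u hu
    have := t.isGE_shift S 1 (-1) 2
    rw [t.zero ψ 0 2, zero_comp]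
  have inj₂ (u : I ⟶ L') (hu : u ≫ f' = 0) : u = 0 := by
    obtain ⟨d, ψ, rfl⟩ := exists_lift₁ hT'.distinguished u hu
    have : t.IsGE (R'⟦(-1 : ℤ)⟧) 1 := t.isGE_shift R' 0 (-1) 1
    rw [t.zero ψ 0 1, zero_comp]
  have e : ι ≫ b ≫ a' = 𝟙 I := by
    rw [← sub_eq_zero]
    refine inj₁ _ (inj₂ _ ?_)
    simp only [Preadditive.sub_comp, Category.assoc, Category.id_comp]
    rw [← reassoc_of% ha', ← ha, ← hb, sub_self]
  let r : Retract I L := ⟨ι ≫ b, a', by rw [Category.assoc, e]⟩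
  let r' : Retract I L' := ⟨ι, b ≫ a', e⟩
  obtain ⟨J, p, q, hJ⟩ := distinguished_cocone_triangle (ι ≫ f')
  obtain ⟨s⟩ := exists_retract_cone hJ hT.distinguished r
    (by rw [hb]; exact Category.assoc _ _ _) (by rw [ha, ha']; exact (Category.assoc _ _ _).symm)
  obtain ⟨s'⟩ := exists_retract_cone hJ hT'.distinguished r' rfl
    (by
      change (b ≫ a') ≫ ι ≫ f' = f'
      rw [Category.assoc, ← reassoc_of% ha', ← ha, ← hb])
  exact ⟨Triangle.mk (ι ≫ f') p q,
    { distinguished := hJ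
      le := (w.le i).prop_of_retract r hT.le
      ge := (w.ge (i + 1)).prop_of_retract s hT.ge
      heart₁ := (t.mem_heart_iff _).2 ⟨hI, isGE_of_retract r' 0 hL'⟩
      heart₂ := hX
      heart₃ := (t.mem_heart_iff _).2 ⟨isLE_of_retract s 0 hR, isGE_of_retract s' 0 hR'⟩ }, rfl⟩

lemma EnvelopeGivesHeart.envelope (h : EnvelopeGivesHeart t A) (ht : IsBoundedTStructure t)
    (X : C) : Envelope (shiftsIn A Set.univ) X :=
  ht.induction _ (fun _ n hX => (h.le _ hX).shift fun Y ⟨i, hY⟩ =>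
    ⟨i, n, Y, trivial, hY, ⟨Iso.refl _⟩⟩) X

lemma EnvelopesGiveTStructure.envelope (h : EnvelopesGiveTStructure t A)
    (ht : IsBoundedTStructure t) (X : C) : Envelope (shiftsIn A Set.univ) X := by
  obtain ⟨-, b, -, hb⟩ := ht X
  have hb : Envelope (shiftsIn A (Set.Ici 0)) (X⟦b⟧) := h.1.le _ (t.le_shift b b 0 (by lia) X hb)
  exact (Envelope _).prop_of_iso ((shiftEquiv C b).unitIso.symm.app X)
    (hb.shift (n := -b) (shiftsOver_shift (S := {p | p.2 ∈ Set.Ici 0})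
      (S' := {p | p.2 ∈ Set.univ}) fun _ _ _ => trivial))

variable [IsTriangulated C]

lemma EnvelopeGivesHeart.hasNiceDecompositions (h : EnvelopeGivesHeart t A)
    (hA : IsSemiOrthogonal A) (hA' : IsAdditiveFamily A)
    (hE : ∀ X, Envelope (shiftsIn A Set.univ) X) :
    HasNiceDecompositions t (hA.weightStructure hA' hE) := by
  have hA₀ (i : ℤ) : A i ≤ t.heart := fun X hX => h.ge _ (.of _ ⟨i, hX⟩)
  have heart (S : Set (ℤ × ℤ)) (hS : ∀ i j, (i, j) ∈ S → j = 0) :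
      Envelope (shiftsOver A S) ≤ t.heart := by
    refine Envelope.le_of_le ?_
    rintro X ⟨i, j, Y, hij, hY, ⟨e⟩⟩
    obtain rfl := hS i j hij
    exact t.heart.prop_of_iso (((shiftFunctorZero C ℤ).app Y).symm ≪≫ e.symm) (hA₀ i Y hY)
  intro X hX i
  have hX' : Envelope (shiftsIn A {0}) X := Envelope.monotone
    (fun Y ⟨i, hY⟩ => ⟨i, 0, Y, rfl, hY, ⟨((shiftFunctorZero C ℤ).app Y).symm⟩⟩) _ (h.le _ hX)
  obtain ⟨L, R, f, g, δ, hT, hL, hR⟩ :=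
    hA.envelope_le_extensionProduct hA' (Set.singleton_nonempty 0) i X hX'
  exact ⟨Triangle.mk f g δ,
    { distinguished := hT
      le := hA.weightStructure_le hA' hE (fun _ _ hij => hij.2) _ hL
      ge := hA.weightStructure_ge hA' hE (fun _ _ hij => hij.2) _ hR
      heart₁ := heart _ (fun _ _ hij => hij.1) _ hL
      heart₂ := hX
      heart₃ := heart _ (fun _ _ hij => hij.1) _ hR }, rfl⟩

lemma EnvelopesGiveTStructure.hasNiceDecompositions (h : EnvelopesGiveTStructure t A)
    (hA : IsSemiOrthogonal A) (hA' : IsAdditiveFamily A)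
    (hE : ∀ X, Envelope (shiftsIn A Set.univ) X) :
    HasNiceDecompositions t (hA.weightStructure hA' hE) := by
  have le_zero {S : Set (ℤ × ℤ)} (hS : ∀ i j, (i, j) ∈ S → 0 ≤ j) {X : C}
      (hX : Envelope (shiftsOver A S) X) : t.IsLE X 0 :=
    ⟨h.1.ge _ (Envelope.monotone (shiftsOver_mono (S' := {p | p.2 ∈ Set.Ici 0})
      fun p hp => hS p.1 p.2 hp) _ hX)⟩
  have ge_zero {S : Set (ℤ × ℤ)} (hS : ∀ i j, (i, j) ∈ S → j ≤ 0) {X : C}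
      (hX : Envelope (shiftsOver A S) X) : t.IsGE X 0 :=
    ⟨h.2.ge _ (Envelope.monotone (shiftsOver_mono (S' := {p | p.2 ∈ Set.Iic 0})
      fun p hp => hS p.1 p.2 hp) _ hX)⟩
  have decomposition {J : Set ℤ} {X L R : C} {f : L ⟶ X} {g : X ⟶ R} {δ : R ⟶ L⟦(1 : ℤ)⟧}
      {i : ℤ} (hT : Triangle.mk f g δ ∈ distTriang C)
      (hL : Envelope (shiftsOver A {p | p.2 ∈ J ∧ p.1 + p.2 ≤ i}) L)
      (hR : Envelope (shiftsOver A {p | p.2 ∈ J ∧ i + 1 ≤ p.1 + p.2}) R) :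
      IsWeightDecomposition (hA.weightStructure hA' hE) i (Triangle.mk f g δ) :=
    ⟨hT, hA.weightStructure_le hA' hE (fun _ _ hij => hij.2) _ hL,
      hA.weightStructure_ge hA' hE (fun _ _ hij => hij.2) _ hR⟩
  intro X hX i
  obtain ⟨h₁, h₂⟩ := (t.mem_heart_iff X).1 hX
  obtain ⟨L, R, f, g, δ, hT, hL, hR⟩ :=
    hA.envelope_le_extensionProduct hA' Set.nonempty_Ici i X (h.1.le _ h₁.le)
  obtain ⟨L', R', f', g', δ', hT', hL', hR'⟩ :=
    hA.envelope_le_extensionProduct hA' Set.nonempty_Iic i X (h.2.le _ h₂.ge)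
  exact exists_isNiceDecomposition_of_le_of_ge hX (decomposition hT hL hR)
    (decomposition hT' hL' hR') (le_zero (fun _ _ hij => hij.1) hL)
    (le_zero (fun _ _ hij => hij.1) hR) (ge_zero (fun _ _ hij => hij.1) hL')
    (ge_zero (fun _ _ hij => hij.1) hR')

end FamiliesToWeights

section GluingTStructure

variable {C : Type u} [Category.{v} C] [HasZeroObject C] [HasShift C ℤ] [Preadditive C]
  [∀ n : ℤ, (shiftFunctor C n).Additive] [Pretriangulated C]
  {A : ℤ → ObjectProperty C}

/-! ### The t-structure glued from semi-simple subcategories -/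

lemma distinguished_of_splitting (S : ShortComplex C) (s : S.Splitting) :
    Triangle.mk S.f S.g 0 ∈ distTriang C :=
  distinguished_of_iso (binaryBiproductTriangle_distinguished S.X₁ S.X₃) (Iso.refl _)
    s.isoBinaryBiproduct.symm (Iso.refl _) (by simp)
    (biprod.hom_ext' _ _ (by simp) (by simp)) (by simp)

/-- The cone of a morphism of a semi-simple abelian subcategory is an extension of its cokernel
by the shift of its kernel. -/
lemma exists_kernel_cokernel_of_isSemisimpleAbelian [IsTriangulated C] (P : ObjectProperty C)
    (hP : IsSemisimpleAbelian P.FullSubcategory) {X Y Z : C} {f : X ⟶ Y} {g : Y ⟶ Z}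
    {δ : Z ⟶ X⟦(1 : ℤ)⟧} (hT : Triangle.mk f g δ ∈ distTriang C) (hX : P X) (hY : P Y) :
    ∃ (K Q : C) (α : K⟦(1 : ℤ)⟧ ⟶ Z) (β : Z ⟶ Q) (γ : Q ⟶ K⟦(1 : ℤ)⟧⟦(1 : ℤ)⟧),
      Triangle.mk α β γ ∈ distTriang C ∧ P K ∧ P Q := by
  let := hP.abelian
  let X' : P.FullSubcategory := ⟨X, hX⟩
  let Y' : P.FullSubcategory := ⟨Y, hY⟩
  let φ : X' ⟶ Y' := homMk f
  let p := Abelian.factorThruImage φ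
  let i := Abelian.image.ι φ
  have hφ : p ≫ i = φ := Abelian.image.fac φ
  obtain ⟨s₁⟩ := hP.splits (ShortComplex.mk (kernel.ι p) p (kernel.condition p))
    { exact := ShortComplex.exact_kernel p }
  obtain ⟨s₂⟩ := hP.splits (ShortComplex.mk i (cokernel.π i) (cokernel.condition i))
    { exact := ShortComplex.exact_cokernel i }
  have h₁ := rot_of_distTriang _ (distinguished_of_splitting _ (s₁.map P.ι))
  have h₂ := distinguished_of_splitting _ (s₂.map P.ι)
  have H := someOctahedron (congr_arg InducedCategory.Hom.hom hφ) h₁ h₂ hT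
  exact ⟨_, _, _, _, _, H.mem, (kernel p).property, (cokernel i).property⟩

variable [IsTriangulated C]

/-- In the nontrivial case, the connecting morphism `Z ⟶ X⟦1⟧` of an extension `X ⟶ Y ⟶ Z` with
`X ∈ A i [j]`, `j < 0`, and `Z ∈ A k [l]`, `l ≥ 0`, is a morphism of `A i`. -/
lemma IsStronglySemiOrthogonal.extensionProduct_le (hA : IsStronglySemiOrthogonal A)
    (hA' : ∀ i, IsSemisimpleAbelian (A i).FullSubcategory) :
    extensionProduct (shiftsIn A (Set.Iic (-1))) (shiftsIn A (Set.Ici 0)) ≤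
      extensionProduct (shiftsIn A (Set.Ici 0)) (shiftsIn A (Set.Iic (-1))) := by
  rintro Y ⟨X, Z, f, g, δ, hT, hX, hZ⟩
  by_cases hδ : δ = 0
  · exact extensionProduct_of_mor₃_eq_zero _ hT hδ hX hZ
  obtain ⟨i, j, X₀, hj, hX₀, ⟨e⟩⟩ := hX
  obtain ⟨k, l, Z₀, hl, hZ₀, ⟨e'⟩⟩ := hZ
  have hj : j ≤ -1 := hj
  have hl : 0 ≤ l := hl
  -- the connecting morphism vanishes unless `j = -1`, `l = 0` and `i = k`
  have key : j = -1 ∧ l = 0 ∧ i = k := by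
    by_contra hne
    refine hδ ?_
    let u : X⟦(1 : ℤ)⟧ ≅ X₀⟦j + 1⟧ :=
      (shiftFunctor C (1 : ℤ)).mapIso e ≪≫ ((shiftFunctorAdd' C j 1 (j + 1) rfl).app X₀).symm
    rw [← cancel_epi e'.inv, ← cancel_mono u.hom, comp_zero, zero_comp]
    refine shift_hom_eq_zero (by lia : (j + 1 - l) + l = j + 1) (fun φ => ?_) _
    by_cases h : j + 1 - l < 0 ∨ k - i < j + 1 - l
    · exact hA.1 k i _ h _ _ hZ₀ hX₀ φ
    · have h₀ : j + 1 - l = 0 := by lia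
      let v : X₀⟦j + 1 - l⟧ ≅ X₀ := (shiftFunctorZero' C (j + 1 - l) h₀).app X₀
      rw [← cancel_mono v.hom, zero_comp]
      exact hA.2 k i (by lia) _ _ hZ₀ hX₀ _
  obtain ⟨rfl, rfl, rfl⟩ := key
  let v : Z ≅ Z₀ := e' ≪≫ (shiftFunctorZero C ℤ).app Z₀
  let u : X⟦(1 : ℤ)⟧ ≅ X₀ :=
    (shiftFunctor C (1 : ℤ)).mapIso e ≪≫ (shiftEquiv C (1 : ℤ)).counitIso.app X₀
  have hT₁ : Triangle.mk δ (-f⟦(1 : ℤ)⟧') (-g⟦(1 : ℤ)⟧') ∈ distTriang C :=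
    rot_of_distTriang _ (rot_of_distTriang _ hT)
  have hT' : Triangle.mk (v.inv ≫ δ ≫ u.hom) (u.inv ≫ (-f⟦(1 : ℤ)⟧'))
      ((-g⟦(1 : ℤ)⟧') ≫ v.hom⟦(1 : ℤ)⟧') ∈ distTriang C :=
    distinguished_of_iso hT₁ v u (Iso.refl (Y⟦(1 : ℤ)⟧)) (v.hom_inv_id_assoc _).symm
      ((Category.comp_id _).trans (u.hom_inv_id_assoc _).symm) (Category.id_comp _).symm
  obtain ⟨K, Q, α, β, γ, hT'', hK, hQ⟩ :=
    exists_kernel_cokernel_of_isSemisimpleAbelian (A i) (hA' i) hT' hZ₀ hX₀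
  obtain ⟨α', β', γ', hY⟩ := exists_shift_distinguished hT'' (-1)
  let c (W : C) : W⟦(1 : ℤ)⟧⟦(-1 : ℤ)⟧ ≅ W := (shiftEquiv C (1 : ℤ)).unitIso.symm.app W
  refine (extensionProduct _ _).prop_of_iso (c Y) ⟨_, _, α', β', γ', hY,
    ⟨i, 0, K, Set.self_mem_Ici, hK, ⟨c K ≪≫ ((shiftFunctorZero C ℤ).app K).symm⟩⟩,
    ⟨i, -1, Q, Set.self_mem_Iic, hQ, ⟨Iso.refl _⟩⟩⟩

/-- The t-structure such that `C^{t ≤ 0}` and `C^{t ≥ 0}` are the envelopes of `A i [j]`, for `j ≥ 0`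
and `j ≤ 0` respectively. -/
def IsStronglySemiOrthogonal.tStructure (hA : IsStronglySemiOrthogonal A)
    (hA₁ : IsAdditiveFamily A) (hA₂ : ∀ i, IsSemisimpleAbelian (A i).FullSubcategory)
    (h : ∀ X, Envelope (shiftsIn A Set.univ) X) : TStructure C where
  le n := Envelope (shiftsIn A (Set.Ici (-n)))
  ge n := Envelope (shiftsIn A (Set.Iic (-n)))
  le_shift n a n' hn X hX := hX.shift (shiftsOver_shift (S := {p | p.2 ∈ Set.Ici (-n)})
    (S' := {p | p.2 ∈ Set.Ici (-n')}) fun i j (hj : -n ≤ j) => show -n' ≤ j + a by lia)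
  ge_shift n a n' hn X hX := hX.shift (shiftsOver_shift (S := {p | p.2 ∈ Set.Iic (-n)})
    (S' := {p | p.2 ∈ Set.Iic (-n')}) fun i j (hj : j ≤ -n) => show j + a ≤ -n' by lia)
  zero' X Y f hX hY := hA.1.envelope_hom_eq_zero (S := {p | p.2 ∈ Set.Ici (-0)})
    (S' := {p | p.2 ∈ Set.Iic (-1)}) (fun i j k l (hj : -0 ≤ j) (hl : l ≤ -1) => by lia) hX hY f
  le_zero_le := Envelope.monotone (shiftsOver_mono (S := {p | p.2 ∈ Set.Ici (-0)})
    (S' := {p | p.2 ∈ Set.Ici (-1)}) fun p (hp : -0 ≤ p.2) => show -1 ≤ p.2 by lia)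
  ge_one_le := Envelope.monotone (shiftsOver_mono (S := {p | p.2 ∈ Set.Iic (-1)})
    (S' := {p | p.2 ∈ Set.Iic (-0)}) fun p (hp : p.2 ≤ -1) => show p.2 ≤ -0 by lia)
  exists_triangle_zero_one X := by
    have : (shiftsIn A (Set.Ici 0)).ContainsZero :=
      hA₁.shiftsOver_containsZero (S := {p | p.2 ∈ Set.Ici 0}) ⟨(0, 0), by simp⟩
    have : (shiftsIn A (Set.Iic (-1))).ContainsZero :=
      hA₁.shiftsOver_containsZero (S := {p | p.2 ∈ Set.Iic (-1)}) ⟨(0, -1), by simp⟩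
    have hX : Envelope (shiftsIn A (Set.Ici 0) ⊔ shiftsIn A (Set.Iic (-1))) X := by
      refine Envelope.monotone ?_ _ (h X)
      rintro Y ⟨i, j, Y₀, -, hY, e⟩
      obtain hj | hj : 0 ≤ j ∨ j ≤ -1 := by lia
      · exact Or.inl ⟨i, j, Y₀, hj, hY, e⟩
      · exact Or.inr ⟨i, j, Y₀, hj, hY, e⟩
    obtain ⟨L, R, f, g, δ, hT, hL, hR⟩ := Envelope.envelope_sup_le (hA.extensionProduct_le hA₂) _ hX
    exact ⟨L, R, neg_zero (G := ℤ) ▸ hL, hR, f, g, δ, hT⟩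

section

variable (hA : IsStronglySemiOrthogonal A) (hA₁ : IsAdditiveFamily A)
  (hA₂ : ∀ i, IsSemisimpleAbelian (A i).FullSubcategory)
  (h : ∀ X, Envelope (shiftsIn A Set.univ) X)

lemma IsStronglySemiOrthogonal.envelopesGiveTStructure :
    EnvelopesGiveTStructure (hA.tStructure hA₁ hA₂ h) A :=
  ⟨congr_arg (fun n : ℤ => Envelope (shiftsIn A (Set.Ici n))) neg_zero,
    congr_arg (fun n : ℤ => Envelope (shiftsIn A (Set.Iic n))) neg_zero⟩

lemma IsStronglySemiOrthogonal.tStructure_isBounded :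
    IsBoundedTStructure (hA.tStructure hA₁ hA₂ h) := by
  intro X
  induction h X with
  | of X hX =>
    obtain ⟨i, j, Y, -, hY, e⟩ := hX
    exact ⟨-j, -j, .of _ ⟨i, j, Y, (neg_neg j).ge, hY, e⟩, .of _ ⟨i, j, Y, (neg_neg j).le, hY, e⟩⟩
  | ext T hT _ _ h₁ h₃ =>
    obtain ⟨a, b, ha, hb⟩ := h₁
    obtain ⟨a', b', ha', hb'⟩ := h₃
    set t := hA.tStructure hA₁ hA₂ h
    exact ⟨min a a', max b b',
      .ext T hT (t.ge_antitone (min_le_left _ _) _ ha) (t.ge_antitone (min_le_right _ _) _ ha'),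
      .ext T hT (t.le_monotone (le_max_left _ _) _ hb) (t.le_monotone (le_max_right _ _) _ hb')⟩

end

end GluingTStructure

end TransversalWeights

open TransversalWeights in
theorem theorem1p6 (C : Type u) [Category.{v} C] [HasZeroObject C] [HasShift C ℤ]
    [Preadditive C] [∀ n : ℤ, (shiftFunctor C n).Additive] [Pretriangulated C]
    [IsTriangulated C] :
    List.TFAE
      [ -- (i)
        ∃ A : ℤ → ObjectProperty C, IsAdditiveFamily A ∧ IsStronglySemiOrthogonal A ∧
          IsGenerating A ∧ ∀ i, IsSemisimpleAbelian (A i).FullSubcategory,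
        -- (ii)
        ∃ A : ℤ → ObjectProperty C, IsAdditiveFamily A ∧ IsSemiOrthogonal A ∧
          ∃ t : TStructure C, IsBoundedTStructure t ∧ EnvelopesGiveTStructure t A,
        -- (ii')
        ∃ A : ℤ → ObjectProperty C, IsAdditiveFamily A ∧ IsSemiOrthogonal A ∧
          ∃ t : TStructure C, IsBoundedTStructure t ∧ EnvelopeGivesHeart t A,
        -- (iii)
        ∃ t : TStructure C, IsBoundedTStructure t ∧
          ∃ A : ℤ → ObjectProperty C, IsAdditiveFamily A ∧ IsSemiOrthogonal A ∧
            (∀ i, A i ≤ t.heart) ∧ HasHeartFiltrations t A,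
        -- (iii')
        ∃ t : TStructure C, IsBoundedTStructure t ∧
          ∃ A : ℤ → ObjectProperty C, IsAdditiveFamily A ∧ IsSemiOrthogonal A ∧
            (∀ i, A i ≤ t.heart) ∧ HasHeartFiltrations t A ∧ HeartFiltrationsFunctorial t A,
        -- (iv)
        ∃ (t : TStructure C) (w : WeightStructure C), IsBoundedTStructure t ∧ w.IsBounded ∧
          HasNiceDecompositions t w,
        -- (iv')
        ∃ (t : TStructure C) (w : WeightStructure C), IsBoundedTStructure t ∧ w.IsBounded ∧
          HasExactNiceDecompositions t w,
        -- (v)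
        ∃ (t : TStructure C) (w : WeightStructure C), IsBoundedTStructure t ∧ w.IsBounded ∧
          SomeImagesExtend t w,
        -- (v')
        ∃ (t : TStructure C) (w : WeightStructure C), IsBoundedTStructure t ∧ w.IsBounded ∧
          AllImagesExtend t w ] ∧
    -- the conditions on a given pair `(t, w)` are equivalent (transversality of `w` and `t`)
    ∀ (t : TStructure C) (w : WeightStructure C), IsBoundedTStructure t → w.IsBounded →
      List.TFAE
        [ HasNiceDecompositions t w, HasExactNiceDecompositions t w,
          SomeImagesExtend t w, AllImagesExtend t w ] := by
  refine ⟨?_, fun t w _ _ => transversal_tfae t w⟩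
  tfae_have 1 → 2 := fun ⟨A, hA, hA', hg, hs⟩ =>
    ⟨A, hA, hA'.1, hA'.tStructure hA hs (hg.envelope hA),
      hA'.tStructure_isBounded hA hs (hg.envelope hA),
      hA'.envelopesGiveTStructure hA hs (hg.envelope hA)⟩
  tfae_have 2 → 6 := fun ⟨A, hA, hA', t, ht, h⟩ =>
    ⟨t, hA'.weightStructure hA (h.envelope ht), ht,
      hA'.weightStructure_isBounded hA (h.envelope ht),
      h.hasNiceDecompositions hA' hA (h.envelope ht)⟩
  tfae_have 6 → 1 := fun ⟨t, w, ht, hw, h⟩ =>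
    ⟨pureHeart t w, pureHeart_isAdditiveFamily t w, h.pureHeart_isStronglySemiOrthogonal,
      h.pureHeart_isGenerating ht hw, h.pureHeart_isSemisimpleAbelian⟩
  tfae_have 6 → 5 := fun ⟨t, w, ht, hw, h⟩ =>
    ⟨t, ht, pureHeart t w, pureHeart_isAdditiveFamily t w, pureHeart_isSemiOrthogonal t w,
      fun _ _ hX => hX.1, h.hasHeartFiltrations hw,
      heartFiltrationsFunctorial (fun _ _ hX => hX.2.1) fun _ _ hX => hX.2.2⟩
  tfae_have 5 → 4 := fun ⟨t, ht, A, hA, hA', h₁, h₂, _⟩ => ⟨t, ht, A, hA, hA', h₁, h₂⟩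
  tfae_have 4 → 3 := fun ⟨t, ht, A, hA, hA', h₁, h₂⟩ =>
    ⟨A, hA, hA', t, ht, h₂.envelopeGivesHeart hA h₁⟩
  tfae_have 3 → 6 := fun ⟨A, hA, hA', t, ht, h⟩ =>
    ⟨t, hA'.weightStructure hA (h.envelope ht), ht,
      hA'.weightStructure_isBounded hA (h.envelope ht),
      h.hasNiceDecompositions hA' hA (h.envelope ht)⟩
  tfae_have 6 ↔ 7 := exists₂_congr fun t w =>
    and_congr_right fun _ => and_congr_right fun _ => (transversal_tfae t w).out 0 1
  tfae_have 6 ↔ 8 := exists₂_congr fun t w =>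
    and_congr_right fun _ => and_congr_right fun _ => (transversal_tfae t w).out 0 2
  tfae_have 6 ↔ 9 := exists₂_congr fun t w =>
    and_congr_right fun _ => and_congr_right fun _ => (transversal_tfae t w).out 0 3
  tfae_finish
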